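/- Let $S=\{a_n\}_{n\ge 1}\subset\mathbb C$ satisfy $0<|a_1|\le|a_2|\le\dots\to\infty$, with finite exponent of convergence $\alpha=\limsup_{n\to\infty}\ln n/\ln|a_n|$. Let $\Psi\in[-\pi,\pi)$ and $\varepsilon>0$ be such that no $a_n$ lies in the open sector $\mathcal I_\varepsilon^c=\{re^{i\theta}: r>0,\ |\theta-\Psi|<\varepsilon\}$. Put $\zeta_S(s)=\sum_{n\ge1}a_n^{-s}$ for $\Re s>\alpha$, where $a_n^{-s}=e^{-s\ln a_n}$ with the branch cut along $\{te^{i\Psi}:t\ge0\}$ and $\arg a_n\in(\Psi-2\pi,\Psi)$. Let $F$ be an entire function whose zeros, counted with multiplicity, are exactly the terms of $S$, and whose order of growth is minimal (that is, at most $\alpha$). Let $\ln F$ be a holomorphic branch of the logarithm of $F$ in $\mathcal I_\varepsilon^c$, and assume that there are integers $m\ge1$, $N\ge0$, a real $\delta>0$ with $N/m>\alpha-\delta$, and complex numbers $d_{j,k}$ such that $$\ln F(z)=\sum_{j=0}^{N}\sum_{k=0}^{1}d_{j,k}\,z^{\alpha-j/m}\ln^k z+o\big(z^{\alpha-N/m-\delta}\big),\qquad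 z\to\infty,\ z\in\mathcal I_\varepsilon^c,$$ where $\ln z$ and the powers of $z$ are formed with the continuous argument on the sector that equals $\Psi$ on the ray $te^{i\Psi}$. Then the limit $\ln F(0):=\lim_{z\to0,\,z\in\mathcal I_\varepsilon^c}\ln F(z)$ exists, $\zeta_S$ has a meromorphic continuation to $\Re s>\alpha-N/m-\delta$ (a half-plane that contains $0$), it is regular at $s=0$, and $$\zeta_S'(0)=\begin{cases}-\ln F(0),&\text{if }\alpha-j/m\ne0\text{ for all }j\in\{0,\dots,N\},\\ i\pi d_{j',1}+d_{j',0}-\ln F(0),&\text{if }\alpha-j'/m=0\text{ for some }j'\in\{0,\dots,N\}.\end{cases}$$ In particular $\zeta_S'(0)=i\pi\,\zeta_S(0)+d_{j',0}-\ln F(0)$, where $d_{j',0}$ is read as $0$ in the first case. -/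

import Mathlib

open Filter Topology Asymptotics

noncomputable section

/-- The open sector of half-opening `ε` around the ray `{t e^{iΨ} : t > 0}`
(angles are understood modulo `2π`, the vertex is not included). -/
def raySector (Ψ ε : ℝ) : Set ℂ :=
  {z | ∃ r θ : ℝ, 0 < r ∧ |θ - Ψ| < ε ∧ z = (r : ℂ) * Complex.exp ((θ : ℂ) * Complex.I)}

/-- The logarithm cut along the ray `{t e^{iΨ} : t ≥ 0}`:
the argument is taken in `(Ψ - 2π, Ψ)` off the cut. -/
def cutLog (Ψ : ℝ) (z : ℂ) : ℂ :=
  Complex.log (-(z * Complex.exp (-((Ψ : ℂ) * Complex.I))))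
    + ((Ψ : ℂ) - (Real.pi : ℂ)) * Complex.I

/-- The power `z ^ w` with the branch cut along the ray `{t e^{iΨ} : t ≥ 0}`. -/
def cutPow (Ψ : ℝ) (z w : ℂ) : ℂ :=
  Complex.exp (w * cutLog Ψ z)

/-- The logarithm that is holomorphic around the ray `{t e^{iΨ} : t > 0}` and equals
`ln t + iΨ` at `t e^{iΨ}`: the argument is taken in `(Ψ - π, Ψ + π]`. -/
def rayLog (Ψ : ℝ) (z : ℂ) : ℂ :=
  Complex.log (z * Complex.exp (-((Ψ : ℂ) * Complex.I))) + (Ψ : ℂ) * Complex.I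

/-- The power `z ^ w` formed with `rayLog Ψ`. -/
def rayPow (Ψ : ℝ) (z w : ℂ) : ℂ :=
  Complex.exp (w * rayLog Ψ z)

/-- The exponent of convergence `limsup (ln n) / (ln |a_n|)`, where `a n` is the
`(n + 1)`-st term of the sequence. -/
def convergenceExponent (a : ℕ → ℂ) : EReal :=
  limsup (fun n : ℕ => ((Real.log ((n : ℝ) + 1) / Real.log ‖a n‖ : ℝ) : EReal)) atTop

/-- Sequences `0 < |a_1| ≤ |a_2| ≤ ... → ∞` with finite exponent of convergence `α`, none of whose
terms lies in the sector of half-opening `ε` around the ray of direction `e^{iΨ}`. -/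
structure IsZetaSequence (a : ℕ → ℂ) (α Ψ ε : ℝ) : Prop where
  norm_pos : 0 < ‖a 0‖
  norm_mono : Monotone fun n => ‖a n‖
  norm_tendsto : Tendsto (fun n => ‖a n‖) atTop atTop
  exponent_eq : convergenceExponent a = (α : EReal)
  neg_pi_le : -Real.pi ≤ Ψ
  lt_pi : Ψ < Real.pi
  eps_pos : 0 < ε
  notMem_sector : ∀ n, a n ∉ raySector Ψ ε

/-- The order of growth of an entire function: the infimum of all `ρ > 0` such that
`F z = O(exp (|z| ^ ρ))` as `z → ∞`. -/
def growthOrder (F : ℂ → ℂ) : EReal :=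
  sInf {x : EReal | ∃ ρ : ℝ, 0 < ρ ∧ x = (ρ : EReal) ∧
    F =O[cocompact ℂ] fun z => Real.exp (‖z‖ ^ ρ)}

/-- `F` is entire, its zeros are the terms of the sequence `a` counted with multiplicity, and its
order of growth is minimal, that is, it does not exceed the exponent of convergence of the zeros
(which is a lower bound for the order of every entire function with these zeros). -/
structure IsCharacteristicFunction (F : ℂ → ℂ) (a : ℕ → ℂ) : Prop where
  entire : Differentiable ℂ F
  zeros : ∀ z : ℂ, analyticOrderAt F z = {n : ℕ | a n = z}.encard
  minimal_order : growthOrder F ≤ convergenceExponent a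

/-- `L` is a holomorphic branch of `ln F` in the open set `U`. -/
structure IsLogBranchOn (L F : ℂ → ℂ) (U : Set ℂ) : Prop where
  holomorphic : DifferentiableOn ℂ L U
  exp_eq : ∀ z ∈ U, Complex.exp (L z) = F z

/-- The expansion
`L z = ∑_{j ≤ N} ∑_{k ≤ M} d_{j,k} z ^ (α - j/m) (ln z) ^ k + o(z ^ (α - N/m - δ))`
as `z → ∞` in the sector of half-opening `ε` around the ray of direction `e^{iΨ}`,
with `m ≥ 1`, `δ > 0` and `N/m > α - δ`. -/
structure HasLogPowerExpansion (L : ℂ → ℂ) (α Ψ ε : ℝ) (d : ℕ → ℕ → ℂ)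
    (m M N : ℕ) (δ : ℝ) : Prop where
  m_pos : 0 < m
  delta_pos : 0 < δ
  lt_div : α - δ < (N : ℝ) / m
  isLittleO :
    (fun z : ℂ => L z - ∑ j ∈ Finset.range (N + 1), ∑ k ∈ Finset.range (M + 1),
        d j k * rayPow Ψ z ((α - (j : ℝ) / m : ℝ) : ℂ) * rayLog Ψ z ^ k)
      =o[cocompact ℂ ⊓ 𝓟 (raySector Ψ ε)] fun z => ‖z‖ ^ (α - (N : ℝ) / m - δ)

/-- `Z` is a meromorphic continuation to the half-plane `Re s > σ` of the function
`ζ_S(s) = ∑ a_n ^ (-s)`, `Re s > α`, the powers being cut along the ray of direction `e^{iΨ}`. -/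
structure IsZetaContinuation (a : ℕ → ℂ) (α Ψ σ : ℝ) (Z : ℂ → ℂ) : Prop where
  meromorphic : MeromorphicOn Z {s : ℂ | σ < s.re}
  hasSum : ∀ s : ℂ, α < s.re → HasSum (fun n => cutPow Ψ (a n) (-s)) (Z s)

end

open Filter Topology Asymptotics MeasureTheory Set
open scoped Polynomial

/-! Put `p = ⌊α⌋`, `u = e^{iΨ}` and `b n = -a n / u`; the rotation carries the cut to the negative
axis, from which the `b n` stay at a positive angle. Minimal order forces the Hadamard form `F'/F =
T + z^p ∑ 1/(a_n^p (z - a_n))` with a polynomial `T` of degree `< p`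
(`IsCharacteristicFunction.exists_logDeriv_eq`). On the ray `z = t u`, let `f(t)` be `ln F(tu)`
minus the primitive of the polynomial part, with constant term `ln F(0)`. Then `f' = ∑ (-t)^p /
(b_n^p (t + b_n))` and `f(0+) = 0`.

For `α < Re s < p + 1`, integration by parts and the termwise integral `∫ t^(c-1)/(t+b) dt = b^(c-1)
π / sin πc` give `∫ t^(-s-1) f(t) dt = π / (s sin πs) · ∑ b_n^(-s)` (`mellin_primitive_eq`,
`mellin_stieltjesSum`).

The expansion of `ln F` at infinity continues this Mellin transform to the left: each term `(A + B
ln t) t^w` contributes `A/(s-w) + B/(s-w)^2` (`exists_mellin_continuation`). Hence `∑ b_n^(-s) =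
(sin πs / πs) · P(s)`, where `P(s) = s^2 ∫ t^(-s-1) f(t) dt` has value `B` and derivative `A` at
`0`, taken from the terms with `w = 0`. Since `sin πs / πs = 1 + O(s^2)`, both survive: `B =
d_{j',1}` and `A = d_{j',0} + iΨ d_{j',1} - ln F(0)`, with `d` read as `0` if no exponent vanishes.
Undoing the rotation multiplies by `e^{-is(Ψ-π)}`, which replaces `iΨ d_{j',1}` by `iπ d_{j',1}`. -/

/-! ### Convergence exponent and summability. -/

theorem IsZetaSequence.ne_zero {a : ℕ → ℂ} {α Ψ ε : ℝ} (ha : IsZetaSequence a α Ψ ε) (n : ℕ) :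
    a n ≠ 0 := by
  have h : ‖a 0‖ ≤ ‖a n‖ := ha.norm_mono (Nat.zero_le n)
  exact norm_pos_iff.1 (ha.norm_pos.trans_le h)

theorem IsZetaSequence.exponent_nonneg {a : ℕ → ℂ} {α Ψ ε : ℝ} (ha : IsZetaSequence a α Ψ ε) :
    0 ≤ α := by
  have h : (0 : EReal) ≤ convergenceExponent a := by
    refine le_limsup_of_frequently_le (Eventually.frequently ?_)
    filter_upwards [ha.norm_tendsto.eventually_ge_atTop 1] with n hn
    have : 0 ≤ Real.log ((n : ℝ) + 1) / Real.log ‖a n‖ :=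
      div_nonneg (Real.log_nonneg (by linarith [n.cast_nonneg (α := ℝ)])) (Real.log_nonneg hn)
    exact_mod_cast this
  rw [ha.exponent_eq] at h
  exact_mod_cast h

/-- For `α < τ < σ` the limsup gives `ln (n+1) < τ ln |a_n|` eventually, so the terms are at most
`(n+1)^(-σ/τ)` with `σ/τ > 1`. -/
theorem IsZetaSequence.summable_norm_rpow {a : ℕ → ℂ} {α Ψ ε : ℝ} (ha : IsZetaSequence a α Ψ ε)
    {σ : ℝ} (hσ : α < σ) : Summable fun n => ‖a n‖ ^ (-σ) := by
  obtain ⟨τ, hτ, hτσ⟩ := exists_between hσ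
  have hτ0 : 0 < τ := ha.exponent_nonneg.trans_lt hτ
  have hlim : limsup (fun n : ℕ => ((Real.log ((n : ℝ) + 1) / Real.log ‖a n‖ : ℝ) : EReal)) atTop
      < (τ : EReal) := by
    have := ha.exponent_eq
    rw [convergenceExponent] at this
    rw [this]
    exact_mod_cast hτ
  have hev := eventually_lt_of_limsup_lt hlim
  have hsum : Summable fun n : ℕ => (((n + 1 : ℕ) : ℝ)) ^ (-(σ / τ)) :=
    (summable_nat_add_iff 1).2 (Real.summable_nat_rpow.2 (by
      rw [neg_lt_neg_iff, one_lt_div hτ0]; exact hτσ))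
  refine summable_of_isBigO_nat hsum (IsBigO.of_bound 1 ?_)
  filter_upwards [hev, ha.norm_tendsto.eventually_gt_atTop 1] with n hn h1
  have hlog : 0 < Real.log ‖a n‖ := Real.log_pos h1
  have hn' : Real.log ((n : ℝ) + 1) / Real.log ‖a n‖ < τ := by exact_mod_cast hn
  rw [div_lt_iff₀ hlog] at hn'
  have hpos : (0 : ℝ) < (n : ℝ) + 1 := by positivity
  rw [Real.norm_of_nonneg (by positivity), Real.norm_of_nonneg (by positivity), one_mul,
    Real.rpow_def_of_pos (by linarith), Real.rpow_def_of_pos (by positivity)]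
  push_cast
  rw [Real.exp_le_exp]
  have h2 : Real.log ((n : ℝ) + 1) * (σ / τ) ≤ τ * Real.log ‖a n‖ * (σ / τ) :=
    mul_le_mul_of_nonneg_right hn'.le (by have := hτ0.trans hτσ; positivity)
  have h3 : τ * Real.log ‖a n‖ * (σ / τ) = Real.log ‖a n‖ * σ := by field_simp
  linarith

/-! ### The integral of `t^(c-1) / (t + b)` over the half-line. -/

/-- After `cos (arg b) ≥ -cos ε`, the difference of the squares of the two sides is at least `(1 +
cos ε)/2 · (‖b‖ - t)^2`. -/
theorem norm_add_lower_bound {b : ℂ} {ε t : ℝ} (ht : 0 ≤ t) (hε : 0 ≤ ε)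
    (hb : |b.arg| ≤ Real.pi - ε) :
    √((1 - Real.cos ε) / 2) * (‖b‖ + t) ≤ ‖(t : ℂ) + b‖ := by
  have hcos : -Real.cos ε ≤ Real.cos b.arg := by
    rw [← Real.cos_abs b.arg, ← Real.cos_pi_sub]
    exact Real.cos_le_cos_of_nonneg_of_le_pi (abs_nonneg _) (by linarith) hb
  have hc1 : 0 ≤ (1 - Real.cos ε) / 2 := by linarith [Real.cos_le_one ε]
  have hre : b.re = ‖b‖ * Real.cos b.arg := (Complex.norm_mul_cos_arg b).symm
  have hsq : ‖(t : ℂ) + b‖ ^ 2 = t ^ 2 + 2 * t * b.re + ‖b‖ ^ 2 := by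
    rw [Complex.sq_norm, Complex.sq_norm, Complex.normSq_apply, Complex.normSq_apply]
    simp
    ring
  refine le_of_sq_le_sq ?_ (norm_nonneg _)
  rw [mul_pow, Real.sq_sqrt hc1, hsq, hre]
  have h1 : -Real.cos ε * (t * ‖b‖) ≤ Real.cos b.arg * (t * ‖b‖) :=
    mul_le_mul_of_nonneg_right hcos (by positivity)
  have h2 : 0 ≤ (1 + Real.cos ε) / 2 * (‖b‖ - t) ^ 2 :=
    mul_nonneg (by linarith [Real.neg_one_le_cos ε]) (sq_nonneg _)
  nlinarith

/-- The substitution `x = t/(1+t)` turns the integral into the Beta integral `B(c, 1-c) = Γ(c)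
Γ(1-c)`, and the reflection formula applies. -/
theorem integral_cpow_div_one_add {c : ℂ} (h0 : 0 < c.re) (h1 : c.re < 1) :
    ∫ t : ℝ in Ioi 0, (t : ℂ) ^ (c - 1) * ((t : ℂ) + 1)⁻¹
      = (Real.pi : ℂ) / Complex.sin (Real.pi * c) := by
  have himage : (fun t : ℝ => t / (1 + t)) '' Ioi 0 = Ioo 0 1 := by
    ext x
    constructor
    · rintro ⟨t, ht, rfl⟩
      have ht : 0 < t := ht
      exact ⟨by positivity, by rw [div_lt_one (by positivity)]; linarith⟩
    · rintro ⟨hx0, hx1⟩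
      refine ⟨x / (1 - x), div_pos hx0 (by linarith), ?_⟩
      have : 1 - x ≠ 0 := by linarith
      have h2 : 1 + x / (1 - x) = 1 / (1 - x) := by field_simp; ring
      simp only [h2]
      field_simp
  have hinj : InjOn (fun t : ℝ => t / (1 + t)) (Ioi 0) := by
    intro x hx y hy h
    have hx : 0 < x := hx
    have hy : 0 < y := hy
    rw [div_eq_div_iff (by positivity) (by positivity)] at h
    linarith
  have hderiv : ∀ t ∈ Ioi (0 : ℝ),
      HasDerivWithinAt (fun t : ℝ => t / (1 + t)) (1 / (1 + t) ^ 2) (Ioi 0) t := by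
    intro t ht
    have ht : 0 < t := ht
    have := (hasDerivAt_id t).div ((hasDerivAt_id t).const_add 1)
      (show (1 : ℝ) + id t ≠ 0 by simp; positivity)
    refine (this.congr_deriv ?_).hasDerivWithinAt
    simp
  have key := integral_image_eq_integral_abs_deriv_smul measurableSet_Ioi hderiv hinj
    (fun x : ℝ => (x : ℂ) ^ (c - 1) * (1 - (x : ℂ)) ^ ((1 - c) - 1))
  rw [himage] at key
  have hbeta : Complex.betaIntegral c (1 - c) = (Real.pi : ℂ) / Complex.sin (Real.pi * c) := by
    have := Complex.Gamma_mul_Gamma_eq_betaIntegral (s := c) (t := 1 - c) h0 (by simpa using h1)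
    rw [Complex.Gamma_mul_Gamma_one_sub] at this
    simpa using this.symm
  rw [← hbeta, Complex.betaIntegral, intervalIntegral.integral_of_le zero_le_one,
    integral_Ioc_eq_integral_Ioo, key]
  refine setIntegral_congr_fun measurableSet_Ioi fun t ht => ?_
  have ht : 0 < t := ht
  have ht1 : (0 : ℝ) < 1 + t := by positivity
  have hne : ((1 + t : ℝ) : ℂ) ≠ 0 := by exact_mod_cast ht1.ne'
  have e1 : (1 : ℂ) - ((t / (1 + t) : ℝ) : ℂ) = ((1 / (1 + t) : ℝ) : ℂ) := by
    push_cast at hne ⊢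
    field_simp
    ring
  simp only [Complex.real_smul]
  rw [e1, abs_of_pos (by positivity), div_eq_mul_inv t (1 + t), one_div (1 + t),
    Complex.ofReal_mul, Complex.mul_cpow_ofReal_nonneg ht.le (by positivity)]
  have e2 : ((((1 + t)⁻¹ : ℝ) : ℂ)) ^ (c - 1) * ((((1 + t)⁻¹ : ℝ) : ℂ)) ^ (1 - c - 1)
      = ((1 + t : ℝ) : ℂ) := by
    rw [← Complex.cpow_add _ _ (Complex.ofReal_ne_zero.2 (inv_ne_zero ht1.ne'))]
    rw [show c - 1 + (1 - c - 1) = ((-1 : ℤ) : ℂ) by push_cast; ring, Complex.cpow_intCast]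
    simp
  calc (t : ℂ) ^ (c - 1) * ((t : ℂ) + 1)⁻¹
      = ((1 / (1 + t) ^ 2 : ℝ) : ℂ) * ((t : ℂ) ^ (c - 1) * ((1 + t : ℝ) : ℂ)) := by
        push_cast at hne ⊢
        rw [add_comm (t : ℂ) 1]
        field_simp
    _ = _ := by rw [← e2]; ring

theorem slitPlane_norm_add_lower_bound {b : ℂ} (hb : b ∈ Complex.slitPlane) :
    ∃ κ > 0, ∀ t : ℝ, 0 ≤ t → κ * (‖b‖ + t) ≤ ‖(t : ℂ) + b‖ := by
  have harg : |b.arg| < Real.pi := 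
    abs_lt.2 ⟨Complex.neg_pi_lt_arg b,
      (Complex.arg_le_pi b).lt_of_ne (Complex.mem_slitPlane_iff_arg.1 hb).1⟩
  refine ⟨√((1 - Real.cos (Real.pi - |b.arg|)) / 2), ?_, fun t ht =>
    norm_add_lower_bound ht (by linarith) (by linarith)⟩
  have : Real.cos (Real.pi - |b.arg|) < 1 := by
    rw [← Real.cos_zero]
    exact Real.cos_lt_cos_of_nonneg_of_le_pi le_rfl (by linarith [abs_nonneg b.arg])
      (by linarith)
  exact Real.sqrt_pos.2 (by linarith)

theorem ne_zero_of_lower_bound {b : ℂ} {κ : ℝ} (hκ : 0 < κ)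
    (hb : ∀ t : ℝ, 0 ≤ t → κ * (‖b‖ + t) ≤ ‖(t : ℂ) + b‖) {t : ℝ} (ht : 0 < t) :
    (t : ℂ) + b ≠ 0 := by
  have := hb t ht.le
  rw [← norm_pos_iff]
  exact lt_of_lt_of_le (by have := norm_nonneg b; positivity) this

theorem norm_inv_add_le {b : ℂ} {κ : ℝ} (hκ : 0 < κ)
    (hb : ∀ t : ℝ, 0 ≤ t → κ * (‖b‖ + t) ≤ ‖(t : ℂ) + b‖) {t : ℝ} (ht : 0 < t) :
    ‖((t : ℂ) + b)⁻¹‖ ≤ κ⁻¹ * (‖b‖ + t)⁻¹ := by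
  rw [norm_inv, ← mul_inv]
  exact inv_anti₀ (by have := norm_nonneg b; positivity) (hb t ht.le)

theorem integrableOn_cpow_mul_inv_add {b : ℂ} (hb : b ∈ Complex.slitPlane) {c : ℂ}
    (h0 : 0 < c.re) (h1 : c.re < 1) :
    IntegrableOn (fun t : ℝ => (t : ℂ) ^ (c - 1) * ((t : ℂ) + b)⁻¹) (Ioi 0) := by
  obtain ⟨κ, hκ, hbd⟩ := slitPlane_norm_add_lower_bound hb
  have hb0 : 0 < ‖b‖ := norm_pos_iff.2 (Complex.slitPlane_ne_zero hb)
  have hle := fun {t : ℝ} (ht : 0 < t) => norm_inv_add_le hκ hbd ht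
  refine mellinConvergent_of_isBigO_rpow (a := 1) (b := 0)
    (f := fun t : ℝ => ((t : ℂ) + b)⁻¹) ?_ ?_ h1 ?_ h0
  · refine ContinuousOn.locallyIntegrableOn ?_ measurableSet_Ioi
    exact ContinuousOn.inv₀ (by fun_prop) fun t ht => ne_zero_of_lower_bound hκ hbd ht
  · refine IsBigO.of_bound κ⁻¹ ?_
    filter_upwards [eventually_gt_atTop 0] with t ht
    refine (hle ht).trans ?_
    rw [Real.norm_of_nonneg (by positivity), Real.rpow_neg_one]
    gcongr
    linarith
  · refine IsBigO.of_bound (κ⁻¹ * ‖b‖⁻¹) ?_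
    filter_upwards [self_mem_nhdsWithin] with t ht
    have ht : 0 < t := ht
    refine (hle ht).trans ?_
    rw [neg_zero, Real.rpow_zero, norm_one, mul_one]
    gcongr
    linarith

/-- Supplies the holomorphy in `b` needed for the identity theorem. The differentiated integrand is
dominated by a multiple of the original one taken at the positive number `‖b‖`. -/
theorem differentiableAt_integral_cpow_mul_inv_add {b : ℂ} (hb : b ∈ Complex.slitPlane) {c : ℂ}
    (h0 : 0 < c.re) (h1 : c.re < 1) :
    DifferentiableAt ℂ
      (fun b : ℂ => ∫ t : ℝ in Ioi 0, (t : ℂ) ^ (c - 1) * ((t : ℂ) + b)⁻¹) b := by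
  obtain ⟨κ, hκ, hbd⟩ := slitPlane_norm_add_lower_bound hb
  have hb0 : 0 < ‖b‖ := norm_pos_iff.2 (Complex.slitPlane_ne_zero hb)
  -- With this radius, moving `b` costs at most half of the lower bound `κ (‖b‖ + t)`.
  set r := κ * ‖b‖ / 2 with hr
  have hr0 : 0 < r := by positivity
  have hlow : ∀ b' ∈ Metric.ball b r, ∀ t : ℝ, 0 < t → κ / 2 * (‖b‖ + t) ≤ ‖(t : ℂ) + b'‖ := by
    intro b' hb' t ht
    have h1 := hbd t ht.le
    have h2 : ‖(t : ℂ) + b‖ ≤ ‖(t : ℂ) + b'‖ + ‖b' - b‖ := by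
      have := norm_sub_le ((t : ℂ) + b') (b' - b)
      rwa [show (t : ℂ) + b' - (b' - b) = t + b by ring] at this
    have h3 : ‖b' - b‖ < r := by simpa [dist_eq_norm] using hb'
    nlinarith [mul_pos hκ ht]
  have hne : ∀ b' ∈ Metric.ball b r, ∀ t : ℝ, 0 < t → (t : ℂ) + b' ≠ 0 := by
    intro b' hb' t ht h
    have := hlow b' hb' t ht
    rw [h, norm_zero] at this
    have : 0 < κ / 2 * (‖b‖ + t) := by positivity
    linarith
  have hbpos : ((‖b‖ : ℝ) : ℂ) ∈ Complex.slitPlane := Complex.ofReal_mem_slitPlane.2 hb0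
  have hcont : ∀ b' ∈ Metric.ball b r,
      ContinuousOn (fun t : ℝ => (t : ℂ) ^ (c - 1) * ((t : ℂ) + b')⁻¹) (Ioi 0) := by
    intro b' hb' t ht
    refine ContinuousAt.continuousWithinAt (ContinuousAt.mul ?_ ?_)
    · exact Complex.continuousAt_ofReal_cpow_const _ _ (Or.inr (ne_of_gt ht))
    · exact ContinuousAt.inv₀ (by fun_prop) (hne b' hb' t ht)
  refine (hasDerivAt_integral_of_dominated_loc_of_deriv_le (μ := volume.restrict (Ioi (0 : ℝ)))
    (F := fun b' (t : ℝ) => (t : ℂ) ^ (c - 1) * ((t : ℂ) + b')⁻¹)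
    (F' := fun b' (t : ℝ) => (t : ℂ) ^ (c - 1) * (-1 / ((t : ℂ) + b') ^ 2))
    (bound := fun t : ℝ => ((κ / 2) ^ 2)⁻¹ * ‖b‖⁻¹ *
      ‖(t : ℂ) ^ (c - 1) * ((t : ℂ) + ((‖b‖ : ℝ) : ℂ))⁻¹‖)
    (s := Metric.ball b r) (Metric.ball_mem_nhds b hr0) ?_ ?_ ?_ ?_ ?_ ?_).2.differentiableAt
  · filter_upwards [Metric.ball_mem_nhds b hr0] with b' hb'
    exact (hcont b' hb').aestronglyMeasurable measurableSet_Ioi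
  · exact integrableOn_cpow_mul_inv_add hb h0 h1
  · refine ContinuousOn.aestronglyMeasurable (fun t ht => ?_) measurableSet_Ioi
    have hne' := hne b (Metric.mem_ball_self hr0) t ht
    refine ContinuousAt.continuousWithinAt (ContinuousAt.mul ?_ ?_)
    · exact Complex.continuousAt_ofReal_cpow_const _ _ (Or.inr (ne_of_gt ht))
    · exact ContinuousAt.div (by fun_prop) (by fun_prop) (pow_ne_zero 2 hne')
  · refine (ae_restrict_mem measurableSet_Ioi).mono fun t ht b' hb' => ?_
    have ht : 0 < t := ht
    have hl := hlow b' hb' t ht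
    have e1 : ‖(t : ℂ) + ((‖b‖ : ℝ) : ℂ)‖ = ‖b‖ + t := by
      rw [← Complex.ofReal_add, Complex.norm_real, Real.norm_of_nonneg (by positivity), add_comm]
    rw [norm_mul, norm_mul, norm_inv, e1, norm_div, norm_neg, norm_one, norm_pow]
    have h2 : 1 / ‖(t : ℂ) + b'‖ ^ 2 ≤ ((κ / 2) ^ 2)⁻¹ * ‖b‖⁻¹ * (‖b‖ + t)⁻¹ := by
      rw [← mul_inv, ← mul_inv, one_div]
      refine inv_anti₀ (by positivity) ?_
      calc (κ / 2) ^ 2 * ‖b‖ * (‖b‖ + t) ≤ (κ / 2) ^ 2 * (‖b‖ + t) * (‖b‖ + t) := by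
            gcongr; linarith
        _ = (κ / 2 * (‖b‖ + t)) ^ 2 := by ring
        _ ≤ _ := by gcongr
    calc _ ≤ ‖(t : ℂ) ^ (c - 1)‖ * (((κ / 2) ^ 2)⁻¹ * ‖b‖⁻¹ * (‖b‖ + t)⁻¹) := by gcongr
      _ = _ := by ring
  · exact (integrableOn_cpow_mul_inv_add hbpos h0 h1).norm.const_mul _
  · refine (ae_restrict_mem measurableSet_Ioi).mono fun t ht b' hb' => ?_
    have := ((hasDerivAt_id b').const_add (t : ℂ)).inv (hne b' hb' t ht)
    exact this.const_mul _

/-- For positive `b`, scale to `b = 1`. Both sides are holomorphic on the connected slit plane, so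
agreement on the positive axis near `1` suffices. -/
theorem integral_cpow_mul_inv_add {b : ℂ} (hb : b ∈ Complex.slitPlane) {c : ℂ}
    (h0 : 0 < c.re) (h1 : c.re < 1) :
    ∫ t : ℝ in Ioi 0, (t : ℂ) ^ (c - 1) * ((t : ℂ) + b)⁻¹
      = b ^ (c - 1) * ((Real.pi : ℂ) / Complex.sin (Real.pi * c)) := by
  have hreal : ∀ x : ℝ, 0 < x → ∫ t : ℝ in Ioi 0, (t : ℂ) ^ (c - 1) * ((t : ℂ) + x)⁻¹
      = (x : ℂ) ^ (c - 1) * ((Real.pi : ℂ) / Complex.sin (Real.pi * c)) := by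
    intro x hx
    have hxc : (x : ℂ) ≠ 0 := by exact_mod_cast hx.ne'
    rw [← integral_cpow_div_one_add h0 h1]
    have hscale := integral_comp_mul_left_Ioi
      (fun t : ℝ => (t : ℂ) ^ (c - 1) * ((t : ℂ) + x)⁻¹) 0 hx
    rw [mul_zero] at hscale
    have : ∫ t : ℝ in Ioi 0, (t : ℂ) ^ (c - 1) * ((t : ℂ) + x)⁻¹
        = x • (x⁻¹ • ∫ t : ℝ in Ioi 0, (t : ℂ) ^ (c - 1) * ((t : ℂ) + x)⁻¹) := by
      rw [smul_smul, mul_inv_cancel₀ hx.ne', one_smul]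
    rw [this, ← hscale, Complex.real_smul, ← integral_const_mul, ← integral_const_mul]
    refine setIntegral_congr_fun measurableSet_Ioi fun t ht => ?_
    have ht : 0 < t := ht
    have hne : (t : ℂ) + 1 ≠ 0 := by
      have : ((t + 1 : ℝ) : ℂ) ≠ 0 := by exact_mod_cast (by positivity : t + 1 ≠ 0)
      simpa using this
    simp only [Complex.ofReal_mul]
    rw [Complex.mul_cpow_ofReal_nonneg hx.le ht.le,
      show (x : ℂ) * t + x = x * (t + 1) by ring, mul_inv]
    field_simp
  have hopen := Complex.isOpen_slitPlane
  have hA : AnalyticOnNhd ℂ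
      (fun b : ℂ => ∫ t : ℝ in Ioi 0, (t : ℂ) ^ (c - 1) * ((t : ℂ) + b)⁻¹) Complex.slitPlane :=
    DifferentiableOn.analyticOnNhd (fun b hb =>
      (differentiableAt_integral_cpow_mul_inv_add hb h0 h1).differentiableWithinAt) hopen
  have hB : AnalyticOnNhd ℂ
      (fun b : ℂ => b ^ (c - 1) * ((Real.pi : ℂ) / Complex.sin (Real.pi * c)))
      Complex.slitPlane :=
    DifferentiableOn.analyticOnNhd (fun b hb =>
      ((DifferentiableAt.cpow differentiableAt_id (differentiableAt_const _) hb).mul_const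
        _).differentiableWithinAt) hopen
  have hone : (1 : ℂ) ∈ Complex.slitPlane := Complex.one_mem_slitPlane
  have hconn : IsPreconnected Complex.slitPlane :=
    (Complex.starConvex_one_slitPlane.isPathConnected hone).isConnected.isPreconnected
  refine hA.eqOn_of_preconnected_of_frequently_eq hB hconn hone ?_ hb
  have htend : Tendsto (fun x : ℝ => (x : ℂ)) (𝓝[≠] 1) (𝓝[≠] 1) := by
    refine tendsto_nhdsWithin_of_tendsto_nhds_of_eventually_within _ ?_ ?_
    · exact (Complex.continuous_ofReal.tendsto' 1 1 (by simp)).mono_left nhdsWithin_le_nhds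
    · filter_upwards [self_mem_nhdsWithin] with x hx
      simpa using hx
  refine htend.frequently (Eventually.frequently ?_)
  filter_upwards [nhdsWithin_le_nhds (lt_mem_nhds (zero_lt_one' ℝ))] with x hx
  exact hreal x hx

/-! ### Hadamard's theorem in logarithmic-derivative form. -/

/-- Iterated Schwarz lemma: `h - h 0` is bounded by `2M`, so `(h - h 0)/z` is bounded by `2M/r` on
the same ball. Each step gains a factor `2‖z‖/r`. -/
theorem exists_polynomial_approx {h : ℂ → ℂ} {r M : ℝ} (hr : 0 < r) (p : ℕ)
    (hd : DifferentiableOn ℂ h (Metric.ball 0 r)) (hM : ∀ z ∈ Metric.ball (0 : ℂ) r, ‖h z‖ ≤ M) :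
    ∃ q : ℂ[X], q.degree < p ∧
      ∀ z ∈ Metric.ball (0 : ℂ) r, ‖h z - q.eval z‖ ≤ M * (2 * ‖z‖ / r) ^ p := by
  induction p generalizing h M with
  | zero => exact ⟨0, by simp, fun z hz => by simpa using hM z hz⟩
  | succ p ih =>
    have h0 : (0 : ℂ) ∈ Metric.ball (0 : ℂ) r := Metric.mem_ball_self hr
    have hmaps : MapsTo h (Metric.ball 0 r) (Metric.closedBall (h 0) (2 * M)) := by
      intro z hz
      rw [Metric.mem_closedBall, dist_eq_norm]
      exact (norm_sub_le _ _).trans (by linarith [hM z hz, hM 0 h0])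
    obtain ⟨q, hq, hqb⟩ := ih
      ((Complex.differentiableOn_dslope (Metric.ball_mem_nhds 0 hr)).2 hd)
      (fun z hz => Complex.norm_dslope_le_div_of_mapsTo_ball hd hmaps hz)
    refine ⟨Polynomial.C (h 0) + Polynomial.X * q, ?_, fun z hz => ?_⟩
    · rw [Polynomial.degree_lt_iff_coeff_zero] at hq ⊢
      intro m hm
      obtain ⟨k, rfl⟩ : ∃ k, m = k + 1 := ⟨m - 1, by omega⟩
      simp [hq k (by omega)]
    · have e := sub_smul_dslope h 0 z
      rw [sub_zero, smul_eq_mul] at e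
      have : h z - (Polynomial.C (h 0) + Polynomial.X * q).eval z
          = z * (dslope h 0 z - q.eval z) := by
        simp only [Polynomial.eval_add, Polynomial.eval_C, Polynomial.eval_mul,
          Polynomial.eval_X]
        linear_combination -e
      rw [this, norm_mul]
      calc ‖z‖ * ‖dslope h 0 z - q.eval z‖ ≤ ‖z‖ * (2 * M / r * (2 * ‖z‖ / r) ^ p) := by
            gcongr; exact hqb z hz
        _ = _ := by rw [pow_succ]; ring

/-- Let `H` be the logarithm of `g / g 0` vanishing at `0`. Then `Re H ≤ A`, so Borel–Carathéodory
gives `‖H‖ ≤ 2A` on radius `R/2`, and Cauchy's estimate on circles of radius `R/4` bounds `H' =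
g'/g`. -/
theorem norm_logDeriv_le_of_ne_zero {g : ℂ → ℂ} {R A : ℝ} (hR : 0 < R) (hA : 0 < A)
    (hd : DifferentiableOn ℂ g (Metric.ball 0 R)) (h0 : ∀ z ∈ Metric.ball (0 : ℂ) R, g z ≠ 0)
    (hb : ∀ z ∈ Metric.ball (0 : ℂ) R, ‖g z‖ ≤ Real.exp A * ‖g 0‖) :
    DifferentiableOn ℂ (logDeriv g) (Metric.ball 0 R) ∧
      ∀ z ∈ Metric.ball (0 : ℂ) (R / 4), ‖logDeriv g z‖ ≤ 8 * A / R := by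
  have hopen : IsOpen (Metric.ball (0 : ℂ) R) := Metric.isOpen_ball
  have hld : DifferentiableOn ℂ (logDeriv g) (Metric.ball 0 R) :=
    (hd.deriv hopen).div hd h0
  refine ⟨hld, fun z hz => ?_⟩
  obtain ⟨H, hH0, hH⟩ := hld.isExactOn_ball.with_val_at 0 0
  have hHd : DifferentiableOn ℂ H (Metric.ball 0 R) := fun z hz =>
    (hH z hz).differentiableAt.differentiableWithinAt
  have hmem0 : (0 : ℂ) ∈ Metric.ball (0 : ℂ) R := Metric.mem_ball_self hR
  have hexp : ∀ z ∈ Metric.ball (0 : ℂ) R, Complex.exp (H z) = g z / g 0 := by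
    intro z hz
    have hconst : g z * Complex.exp (-H z) = g 0 * Complex.exp (-H 0) := by
      refine hopen.is_const_of_deriv_eq_zero (𝕜 := ℂ)
        (f := fun z => g z * Complex.exp (-H z))
        (convex_ball (0 : ℂ) R).isPreconnected ?_ ?_ hz hmem0
      · exact hd.mul (hHd.neg.cexp)
      · intro w hw
        have h1 : HasDerivAt g (deriv g w) w :=
          ((hd w hw).differentiableAt (hopen.mem_nhds hw)).hasDerivAt
        have h2 := h1.mul ((hH w hw).neg.cexp)
        refine h2.deriv.trans ?_
        have := h0 w hw
        simp only [logDeriv_apply, Pi.zero_apply, Pi.neg_apply]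
        field_simp
        ring
    rw [hH0, neg_zero, Complex.exp_zero, mul_one, Complex.exp_neg] at hconst
    have h1 := h0 0 hmem0
    have h2 := Complex.exp_ne_zero (H z)
    field_simp at hconst ⊢
    rw [hconst, mul_comm]
  have hRe : MapsTo H (Metric.ball 0 R) {w | w.re ≤ A} := by
    intro w hw
    have h1 : Real.exp (H w).re = ‖g w‖ / ‖g 0‖ := by
      rw [← Complex.norm_exp, hexp w hw, norm_div]
    have h2 : ‖g w‖ / ‖g 0‖ ≤ Real.exp A :=
      (div_le_iff₀ (norm_pos_iff.2 (h0 0 hmem0))).2 (hb w hw)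
    rw [← h1] at h2
    exact Real.exp_le_exp.1 h2
  have hbound : ∀ w : ℂ, ‖w‖ ≤ R / 2 → ‖H w‖ ≤ 2 * A := by
    intro w hw
    have hwR : w ∈ Metric.ball (0 : ℂ) R := by rw [mem_ball_zero_iff]; linarith
    refine (Complex.borelCaratheodory_zero hA hHd hRe hR hwR hH0).trans ?_
    rw [div_le_iff₀ (by linarith)]
    nlinarith
  rw [mem_ball_zero_iff] at hz
  have hsub : Metric.closedBall z (R / 4) ⊆ Metric.ball 0 R := by
    intro w hw
    rw [Metric.mem_closedBall, dist_eq_norm] at hw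
    rw [mem_ball_zero_iff]
    have := norm_le_norm_add_norm_sub' w z
    linarith
  have hzR : z ∈ Metric.ball (0 : ℂ) R := hsub (Metric.mem_closedBall_self (by positivity))
  rw [← (hH z hzR).deriv]
  have := Complex.norm_deriv_le_of_forall_mem_sphere_norm_le (f := H) (c := z) (R := R / 4)
    (C := 2 * A) (by positivity) (hHd.diffContOnCl_ball hsub) (fun w hw => hbound w (by
      rw [mem_sphere_iff_norm] at hw
      have := norm_le_norm_add_norm_sub' w z
      linarith))
  refine this.trans (le_of_eq ?_)
  field_simp
  norm_num

/-- Zeros are divided out one index at a time; counting the remaining indices `i ≥ n` keeps track of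
repeated zeros. -/
theorem exists_entire_quotient {a : ℕ → ℂ} {F : ℂ → ℂ} (ha : ∀ n, a n ≠ 0)
    (hd : Differentiable ℂ F)
    (hz : ∀ z : ℂ, analyticOrderAt F z = {n : ℕ | a n = z}.encard) (n : ℕ) :
    ∃ g : ℂ → ℂ, Differentiable ℂ g ∧ (∀ z, F z = (∏ i ∈ Finset.range n, (1 - z / a i)) * g z) ∧
      ∀ z : ℂ, analyticOrderAt g z = {i : ℕ | n ≤ i ∧ a i = z}.encard := by
  induction n with
  | zero => exact ⟨F, hd, by simp, by simpa using hz⟩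
  | succ n ih =>
    obtain ⟨g, hg, hFg, hord⟩ := ih
    have hgn : g (a n) = 0 := by
      refine apply_eq_zero_of_analyticOrderAt_ne_zero ?_
      rw [hord, Set.encard_ne_zero]
      exact ⟨n, le_rfl, rfl⟩
    have hg' : Differentiable ℂ (dslope g (a n)) := by
      rw [← differentiableOn_univ, Complex.differentiableOn_dslope univ_mem]
      exact hg.differentiableOn
    have hfac : ∀ z, g z = (1 - z / a n) * (-a n * dslope g (a n) z) := by
      intro z
      have e := sub_smul_dslope g (a n) z
      rw [hgn, sub_zero, smul_eq_mul] at e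
      rw [← e]
      field_simp [ha n]
      ring
    refine ⟨fun z => -a n * dslope g (a n) z, hg'.const_mul _, fun z => ?_, fun z => ?_⟩
    · rw [Finset.prod_range_succ, hFg z, mul_assoc, ← hfac z]
    · have hlin : AnalyticAt ℂ (fun w : ℂ => 1 - w / a n) z := by fun_prop
      have hq : AnalyticAt ℂ (fun z => -a n * dslope g (a n) z) z :=
        (hg'.const_mul _).analyticAt z
      have hmul := analyticOrderAt_mul hlin hq
      have hgeq : ((fun w : ℂ => 1 - w / a n) * fun z => -a n * dslope g (a n) z) = g := by
        funext w
        exact (hfac w).symm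
      rw [hgeq, hord] at hmul
      by_cases hzn : a n = z
      · have h1 : analyticOrderAt (fun w : ℂ => 1 - w / a n) z = 1 := by
          refine hlin.analyticOrderAt_eq_one_of_zero_deriv_ne_zero ?_ ?_
          · rw [← hzn, div_self (ha n), sub_self]
          · simp [ha n]
        have h2 : {i : ℕ | n ≤ i ∧ a i = z} = insert n {i : ℕ | n + 1 ≤ i ∧ a i = z} := by
          ext i
          simp only [mem_ofPred_eq, mem_insert_iff]
          constructor
          · rintro ⟨h, h'⟩
            rcases h.eq_or_lt with rfl | h
            · exact Or.inl rfl
            · exact Or.inr ⟨h, h'⟩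
          · rintro (rfl | ⟨h, h'⟩)
            · exact ⟨le_rfl, hzn⟩
            · exact ⟨by omega, h'⟩
        rw [h1, h2, Set.encard_insert_of_notMem (by simp), add_comm] at hmul
        exact (ENat.add_right_injective_of_ne_top ENat.one_ne_top hmul).symm
      · have h1 : analyticOrderAt (fun w : ℂ => 1 - w / a n) z = 0 := by
          rw [hlin.analyticOrderAt_eq_zero, sub_ne_zero]
          intro h
          rw [eq_div_iff (ha n), one_mul] at h
          exact hzn h
        have h2 : {i : ℕ | n ≤ i ∧ a i = z} = {i : ℕ | n + 1 ≤ i ∧ a i = z} := by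
          ext i
          simp only [mem_ofPred_eq]
          constructor
          · rintro ⟨h, h'⟩
            rcases h.eq_or_lt with rfl | h
            · exact absurd h' hzn
            · exact ⟨h, h'⟩
          · rintro ⟨h, h'⟩
            exact ⟨by omega, h'⟩
        rw [h1, zero_add, h2] at hmul
        exact hmul.symm

theorem exists_growth_bound {F : ℂ → ℂ} {β : ℝ} (hF : Continuous F)
    (ho : growthOrder F < (β : EReal)) :
    ∃ ρ : ℝ, 0 < ρ ∧ ρ < β ∧ ∃ C : ℝ, ∀ z, ‖F z‖ ≤ C * Real.exp (‖z‖ ^ ρ) := by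
  obtain ⟨x, ⟨ρ, hρ, rfl, hO⟩, hx⟩ := sInf_lt_iff.1 ho
  refine ⟨ρ, hρ, by exact_mod_cast hx, ?_⟩
  obtain ⟨c, hc⟩ := hO.bound
  obtain ⟨K, hK, hKc⟩ := mem_cocompact.1 hc
  obtain ⟨D, hD⟩ := hK.exists_bound_of_continuousOn hF.continuousOn
  refine ⟨max c D, fun z => ?_⟩
  have hexp : 1 ≤ Real.exp (‖z‖ ^ ρ) := Real.one_le_exp (by positivity)
  by_cases hz : z ∈ K
  · have h1 := hD z hz
    have h2 : 0 ≤ D := (norm_nonneg _).trans h1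
    calc ‖F z‖ ≤ max c D * 1 := by rw [mul_one]; exact h1.trans (le_max_right _ _)
      _ ≤ _ := by gcongr
  · have h1 := hKc hz
    rw [mem_ofPred_eq, Real.norm_of_nonneg (Real.exp_nonneg _)] at h1
    refine h1.trans ?_
    gcongr
    exact le_max_left _ _

theorem exists_polynomial_inv_sub {a : ℂ} (ha : a ≠ 0) (p : ℕ) :
    ∃ q : ℂ[X], q ∈ Polynomial.degreeLT ℂ p ∧
      ∀ z, z ≠ a → (z - a)⁻¹ = q.eval z + z ^ p * (a ^ p * (z - a))⁻¹ := by
  induction p with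
  | zero => exact ⟨0, Submodule.zero_mem _, fun z _ => by simp⟩
  | succ p ih =>
    obtain ⟨q, hq, hqe⟩ := ih
    refine ⟨q - Polynomial.C (a ^ (p + 1))⁻¹ * Polynomial.X ^ p, Submodule.sub_mem _
      (Polynomial.degreeLT_mono (Nat.le_succ p) hq) ?_, fun z hz => ?_⟩
    · rw [Polynomial.mem_degreeLT]
      exact (Polynomial.degree_C_mul_X_pow_le _ _).trans_lt (by exact_mod_cast Nat.lt_succ_self p)
    · have h1 : z - a ≠ 0 := sub_ne_zero.2 hz
      rw [hqe z hz]
      simp only [Polynomial.eval_sub, Polynomial.eval_mul, Polynomial.eval_C,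
        Polynomial.eval_pow, Polynomial.eval_X]
      rw [pow_succ, pow_succ]
      field_simp
      ring

/-- With `R = ‖a n‖`, the quotient `g` of `F` by its first `n` linear factors has no zero in `‖z‖ <
R`. The growth of `F` bounds `g'/g`, which is then approximated by a polynomial of degree `< p`. The
polynomial parts of the expansions of `1/(z - a i)` are absorbed into `T`. The assumption `C ≥ e ‖F
0‖` only makes the logarithm at least `1`. -/
theorem exists_polynomial_logDeriv_approx {a : ℕ → ℂ} {F : ℂ → ℂ} (ha : ∀ n, a n ≠ 0)
    (hmono : Monotone fun n => ‖a n‖) (hd : Differentiable ℂ F)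
    (hz : ∀ z : ℂ, analyticOrderAt F z = {n : ℕ | a n = z}.encard) {ρ C : ℝ}
    (hC : ∀ z, ‖F z‖ ≤ C * Real.exp (‖z‖ ^ ρ)) (hC0 : Real.exp 1 * ‖F 0‖ ≤ C) (p n : ℕ) :
    ∃ T ∈ Polynomial.degreeLT ℂ p, ∀ z, F z ≠ 0 → ‖z‖ < ‖a n‖ / 4 →
      ‖logDeriv F z - (T.eval z + z ^ p * ∑ i ∈ Finset.range n, (a i ^ p * (z - a i))⁻¹)‖
        ≤ 8 * ((2 * ‖a n‖) ^ ρ + Real.log (C / ‖F 0‖)) / ‖a n‖ * (8 * ‖z‖ / ‖a n‖) ^ p := by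
  obtain ⟨g, hg, hFg, hord⟩ := exists_entire_quotient ha hd hz n
  set R := ‖a n‖ with hRdef
  have hR : 0 < R := norm_pos_iff.2 (ha n)
  have hg0 : g 0 = F 0 := by simp [hFg 0]
  have hF0 : F 0 ≠ 0 := by
    rw [← (hd.analyticAt 0).analyticOrderAt_eq_zero, hz, Set.encard_eq_zero]
    exact Set.eq_empty_of_forall_notMem fun i hi => ha i hi
  have hF0' : 0 < ‖F 0‖ := norm_pos_iff.2 hF0
  have hCpos : 0 < C := lt_of_lt_of_le (by positivity) hC0
  have hlog : 1 ≤ Real.log (C / ‖F 0‖) := by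
    rw [Real.le_log_iff_exp_le (by positivity), le_div_iff₀ hF0']
    exact hC0
  have hA : 0 < (2 * R) ^ ρ + Real.log (C / ‖F 0‖) := by positivity
  have hgne : ∀ z ∈ Metric.ball (0 : ℂ) R, g z ≠ 0 := by
    intro z hzR
    rw [← (hg.analyticAt z).analyticOrderAt_eq_zero, hord, Set.encard_eq_zero]
    refine Set.eq_empty_of_forall_notMem fun i hi => ?_
    rw [mem_ball_zero_iff, ← hi.2] at hzR
    exact absurd (hmono hi.1) (not_le.2 hzR)
  -- On radius `2R` every factor satisfies `|1 - z/a_i| ≥ 1`, so `|g| ≤ |F|` there; the maximum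
  -- principle carries the bound inside.
  have hsphere : ∀ z, ‖z‖ = 2 * R → ‖g z‖ ≤ C * Real.exp ((2 * R) ^ ρ) := by
    intro z hzR
    have h1 := hC z
    rw [hFg z, norm_mul, norm_prod, hzR] at h1
    refine le_trans ?_ h1
    refine le_mul_of_one_le_left (norm_nonneg _) ?_
    rw [← Finset.prod_const_one (s := Finset.range n)]
    refine Finset.prod_le_prod (fun _ _ => zero_le_one) fun i hi => ?_
    have h2 : ‖a i‖ ≤ R := hmono (Finset.mem_range.1 hi).le
    have h3 : 2 ≤ ‖z / a i‖ := by
      rw [norm_div, le_div_iff₀ (norm_pos_iff.2 (ha i)), hzR]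
      linarith
    have h4 := norm_sub_norm_le (z / a i) 1
    rw [norm_one, norm_sub_rev] at h4
    linarith
  have hgb : ∀ z ∈ Metric.ball (0 : ℂ) R,
      ‖g z‖ ≤ Real.exp ((2 * R) ^ ρ + Real.log (C / ‖F 0‖)) * ‖g 0‖ := by
    intro z hzR
    rw [Real.exp_add, Real.exp_log (by positivity), hg0, mul_assoc, div_mul_cancel₀ _ hF0'.ne',
      mul_comm]
    refine Complex.norm_le_of_forall_mem_frontier_norm_le (U := Metric.ball (0 : ℂ) (2 * R))
      Metric.isBounded_ball hg.diffContOnCl (fun w hw => hsphere w ?_) (subset_closure ?_)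
    · rw [frontier_ball _ (by positivity), mem_sphere_zero_iff_norm] at hw
      exact hw
    · exact Metric.ball_subset_ball (by linarith) hzR
  obtain ⟨hld, hlb⟩ := norm_logDeriv_le_of_ne_zero hR hA hg.differentiableOn hgne hgb
  have hR4 : 0 < R / 4 := by positivity
  obtain ⟨q, hq, hqb⟩ := exists_polynomial_approx hR4 p
    (hld.mono (Metric.ball_subset_ball (by linarith))) hlb
  choose s hs hse using fun i => exists_polynomial_inv_sub (ha i) p
  refine ⟨q + ∑ i ∈ Finset.range n, s i, Submodule.add_mem _ (Polynomial.mem_degreeLT.2 hq)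
    (Submodule.sum_mem _ fun i _ => hs i), fun z hFz hzR => ?_⟩
  have hprod : ∏ i ∈ Finset.range n, (1 - z / a i) ≠ 0 := fun h => hFz (by rw [hFg, h, zero_mul])
  have hza : ∀ i ∈ Finset.range n, z ≠ a i := by
    intro i hi h
    refine Finset.prod_ne_zero_iff.1 hprod i hi ?_
    rw [h, div_self (ha i), sub_self]
  have hgz : g z ≠ 0 := fun h => hFz (by rw [hFg, h, mul_zero])
  have hlogF : logDeriv F z = ∑ i ∈ Finset.range n, (z - a i)⁻¹ + logDeriv g z := by
    have : F = fun z => (∏ i ∈ Finset.range n, (1 - z / a i)) * g z := funext hFg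
    rw [this, logDeriv_mul z hprod hgz (by fun_prop) (hg z), logDeriv_prod
      (fun i hi => Finset.prod_ne_zero_iff.1 hprod i hi) (fun i _ => by fun_prop)]
    congr 1
    refine Finset.sum_congr rfl fun i hi => ?_
    have h1 : z - a i ≠ 0 := sub_ne_zero.2 (hza i hi)
    have h2 : a i - z ≠ 0 := sub_ne_zero.2 (hza i hi).symm
    have h3 := ha i
    have h4 : deriv (fun z : ℂ => 1 - z / a i) z = -(1 / a i) := by simp
    rw [logDeriv_apply, h4, one_sub_div h3]
    field_simp
    ring
  have hzball : z ∈ Metric.ball (0 : ℂ) (R / 4) := mem_ball_zero_iff.2 hzR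
  have hfin := hqb z hzball
  have e : logDeriv F z - ((q + ∑ i ∈ Finset.range n, s i).eval z
      + z ^ p * ∑ i ∈ Finset.range n, (a i ^ p * (z - a i))⁻¹) = logDeriv g z - q.eval z := by
    rw [hlogF, Finset.sum_congr rfl fun i hi => hse i z (hza i hi), Finset.sum_add_distrib,
      ← Finset.mul_sum, Polynomial.eval_add, Polynomial.eval_finsetSum]
    ring
  rw [e]
  refine hfin.trans (le_of_eq ?_)
  congr 2
  field_simp
  ring

/-- Lagrange interpolation at `p` points of `s` expresses every other value linearly through the
values at those points, and such a relation passes to the limit. -/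
theorem exists_polynomial_of_tendsto {p : ℕ} {T : ℕ → ℂ[X]} (hT : ∀ n, T n ∈ Polynomial.degreeLT ℂ p)
    {s : Set ℂ} (hs : s.Infinite) {f : ℂ → ℂ}
    (h : ∀ z ∈ s, Tendsto (fun n => (T n).eval z) atTop (𝓝 (f z))) :
    ∃ q ∈ Polynomial.degreeLT ℂ p, ∀ z ∈ s, f z = q.eval z := by
  obtain ⟨t, hts, htc⟩ := hs.exists_subset_card_eq p
  refine ⟨Lagrange.interpolate t id f, ?_, fun z hz => ?_⟩
  · rw [Polynomial.mem_degreeLT, ← htc]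
    exact Lagrange.degree_interpolate_lt _ Function.injective_id.injOn
  · refine tendsto_nhds_unique (h z hz) ?_
    have e : ∀ n, (T n).eval z = ∑ i ∈ t, (T n).eval i * (Lagrange.basis t id i).eval z := by
      intro n
      have := Lagrange.eq_interpolate (s := t) (v := (id : ℂ → ℂ)) (f := T n)
        Function.injective_id.injOn (by rw [htc]; exact Polynomial.mem_degreeLT.1 (hT n))
      conv_lhs => rw [this]
      simp [Lagrange.interpolate_apply, Polynomial.eval_finsetSum]
    simp_rw [e]
    rw [Lagrange.interpolate_apply, Polynomial.eval_finsetSum]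
    refine tendsto_finsetSum _ fun i hi => ?_
    simpa using (h i (hts hi)).mul_const _

/-- The order is below `p + 1`, so some growth exponent `ρ < p + 1` is available and the
finite-stage error, of size `‖a n‖^(ρ-1-p)`, tends to `0`. The sums converge, hence so do the
polynomials `T n`, pointwise where `F ≠ 0`. -/
theorem IsCharacteristicFunction.exists_logDeriv_eq {a : ℕ → ℂ} {α Ψ ε : ℝ} {F : ℂ → ℂ}
    (ha : IsZetaSequence a α Ψ ε) (hF : IsCharacteristicFunction F a) {p : ℕ}
    (hp : α < (p + 1 : ℝ)) :
    ∃ T ∈ Polynomial.degreeLT ℂ p, ∀ z, F z ≠ 0 →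
      logDeriv F z = T.eval z + z ^ p * ∑' n, (a n ^ p * (z - a n))⁻¹ := by
  obtain ⟨ρ, hρ0, hρ, C₀, hC₀⟩ := exists_growth_bound (β := p + 1) hF.entire.continuous (by
    refine hF.minimal_order.trans_lt ?_
    rw [ha.exponent_eq]
    exact_mod_cast hp)
  set C := max C₀ (Real.exp 1 * ‖F 0‖) with hCdef
  have hC : ∀ z, ‖F z‖ ≤ C * Real.exp (‖z‖ ^ ρ) := fun z =>
    (hC₀ z).trans (by gcongr; exact le_max_left _ _)
  choose T hT hTb using exists_polynomial_logDeriv_approx ha.ne_zero ha.norm_mono hF.entire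
    hF.zeros hC (le_max_right _ _) p
  have hsummable : ∀ z, Summable fun n => (a n ^ p * (z - a n))⁻¹ := by
    intro z
    refine summable_of_isBigO_nat (ha.summable_norm_rpow hp) (IsBigO.of_bound 2 ?_)
    filter_upwards [ha.norm_tendsto.eventually_ge_atTop (2 * ‖z‖)] with n hn
    have h0 : 0 < ‖a n‖ := norm_pos_iff.2 (ha.ne_zero n)
    have h1 : ‖a n‖ / 2 ≤ ‖z - a n‖ := by
      have := norm_sub_norm_le (a n) z
      rw [norm_sub_rev] at this
      linarith
    rw [norm_inv, norm_mul, norm_pow, Real.norm_of_nonneg (by positivity), Real.rpow_neg h0.le,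
      show (p + 1 : ℝ) = ((p + 1 : ℕ) : ℝ) by push_cast; ring, Real.rpow_natCast, pow_succ,
      show (2 : ℝ) * (‖a n‖ ^ p * ‖a n‖)⁻¹ = (‖a n‖ ^ p * (‖a n‖ / 2))⁻¹ by field_simp]
    exact inv_anti₀ (by positivity) (by gcongr)
  have herr : ∀ z : ℂ, Tendsto (fun n => 8 * ((2 * ‖a n‖) ^ ρ + Real.log (C / ‖F 0‖)) / ‖a n‖
      * (8 * ‖z‖ / ‖a n‖) ^ p) atTop (𝓝 0) := by
    intro z
    have h1 : Tendsto (fun x : ℝ => 8 * (8 * ‖z‖) ^ p * (2 ^ ρ * x ^ (-((p : ℝ) + 1 - ρ))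
        + Real.log (C / ‖F 0‖) * x ^ (-((p : ℝ) + 1)))) atTop (𝓝 0) := by
      have e1 := (tendsto_rpow_neg_atTop (y := (p : ℝ) + 1 - ρ) (by linarith)).const_mul
        ((2 : ℝ) ^ ρ)
      have e2 := (tendsto_rpow_neg_atTop (y := (p : ℝ) + 1) (by positivity)).const_mul
        (Real.log (C / ‖F 0‖))
      simpa using (e1.add e2).const_mul (8 * (8 * ‖z‖) ^ p)
    refine (h1.comp ha.norm_tendsto).congr fun n => ?_
    have h0 : 0 < ‖a n‖ := norm_pos_iff.2 (ha.ne_zero n)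
    simp only [Function.comp_apply]
    rw [neg_sub, Real.rpow_sub h0, Real.rpow_neg h0.le,
      show (p + 1 : ℝ) = ((p + 1 : ℕ) : ℝ) by push_cast; ring, Real.rpow_natCast,
      Real.mul_rpow zero_le_two h0.le, div_pow]
    field_simp
    ring
  have hlim : ∀ z, F z ≠ 0 → Tendsto (fun n => (T n).eval z) atTop
      (𝓝 (logDeriv F z - z ^ p * ∑' n, (a n ^ p * (z - a n))⁻¹)) := by
    intro z hz
    have h1 := squeeze_zero_norm' (f := fun n => logDeriv F z - ((T n).eval z
      + z ^ p * ∑ i ∈ Finset.range n, (a i ^ p * (z - a i))⁻¹)) ?_ (herr z)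
    · have h2 := ((hsummable z).hasSum.tendsto_sum_nat.const_mul (z ^ p)).const_sub (logDeriv F z)
      have h3 := h2.sub h1
      rw [sub_zero] at h3
      exact h3.congr fun n => by ring
    · filter_upwards [ha.norm_tendsto.eventually_gt_atTop (4 * ‖z‖)] with n hn
      exact hTb n z hz (by linarith)
  have hF0 : F 0 ≠ 0 := by
    rw [← (hF.entire.analyticAt 0).analyticOrderAt_eq_zero, hF.zeros, Set.encard_eq_zero]
    exact Set.eq_empty_of_forall_notMem fun i hi => ha.ne_zero i hi
  have hinf : {z | F z ≠ 0}.Infinite :=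
    infinite_of_mem_nhds 0 (hF.entire.continuous.continuousAt.eventually_ne hF0)
  obtain ⟨q, hq, hqe⟩ := exists_polynomial_of_tendsto hT hinf hlim
  exact ⟨q, hq, fun z hz => by rw [← hqe z hz]; ring⟩

/-! ### Stieltjes sums and their Mellin transforms. -/

/-- The Stieltjes-type sum `∑ (-t) ^ p / (b_n ^ p (t + b_n))`. -/
noncomputable def stieltjesSum (b : ℕ → ℂ) (p : ℕ) (t : ℝ) : ℂ :=
  ∑' n, (-(t : ℂ)) ^ p * (b n ^ p * ((t : ℂ) + b n))⁻¹

/-- A sequence `b` of exponent of convergence at most `α` staying away from the negative axis,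
together with the genus `p = ⌊α⌋`. -/
structure IsStieltjesSequence (b : ℕ → ℂ) (α κ : ℝ) (p : ℕ) : Prop where
  kappa_pos : 0 < κ
  lower : ∀ n, ∀ t : ℝ, 0 ≤ t → κ * (‖b n‖ + t) ≤ ‖(t : ℂ) + b n‖
  ne_zero : ∀ n, b n ≠ 0
  summable : ∀ σ : ℝ, α < σ → Summable fun n => ‖b n‖ ^ (-σ)
  le_exponent : (p : ℝ) ≤ α
  exponent_lt : α < p + 1

namespace IsStieltjesSequence

variable {b : ℕ → ℂ} {α κ : ℝ} {p : ℕ}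

theorem mem_slitPlane (hb : IsStieltjesSequence b α κ p) (n : ℕ) : b n ∈ Complex.slitPlane := by
  rw [Complex.mem_slitPlane_iff]
  by_contra! h
  have h1 := hb.lower n (-(b n).re) (by linarith [h.1])
  have h2 : ((-(b n).re : ℝ) : ℂ) + b n = 0 := by
    apply Complex.ext <;> simp [h.2]
  rw [h2, norm_zero] at h1
  have h3 : 0 < ‖b n‖ := norm_pos_iff.2 (hb.ne_zero n)
  nlinarith [hb.kappa_pos, mul_pos hb.kappa_pos h3, mul_nonneg hb.kappa_pos.le (neg_nonneg.2 h.1)]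

/-- Interpolates between the behaviours for small and large `t` through `‖b‖ + t ≥ t^(p+1-σ)
‖b‖^(σ-p)`. The choice `σ = p + 1` serves `t → 0`, and `σ` close to `α` serves `t → ∞`. -/
theorem norm_term_le (hb : IsStieltjesSequence b α κ p) (n : ℕ) {t σ : ℝ} (ht : 0 < t)
    (hσ : p ≤ σ) (hσ' : σ ≤ p + 1) :
    ‖(-(t : ℂ)) ^ p * (b n ^ p * ((t : ℂ) + b n))⁻¹‖
      ≤ κ⁻¹ * t ^ (σ - 1) * ‖b n‖ ^ (-σ) := by
  have hb0 : 0 < ‖b n‖ := norm_pos_iff.2 (hb.ne_zero n)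
  have hκ := hb.kappa_pos
  have h1 := norm_inv_add_le hκ (hb.lower n) ht
  have h2 : t ^ ((p : ℝ) + 1 - σ) * ‖b n‖ ^ (σ - p) ≤ ‖b n‖ + t := by
    calc t ^ ((p : ℝ) + 1 - σ) * ‖b n‖ ^ (σ - p)
        ≤ (‖b n‖ + t) ^ ((p : ℝ) + 1 - σ) * (‖b n‖ + t) ^ (σ - p) := by
          gcongr <;> linarith
      _ = ‖b n‖ + t := by
          rw [← Real.rpow_add (by positivity)]
          ring_nf
          exact Real.rpow_one _
  rw [norm_mul, norm_pow, norm_neg, Complex.norm_real, Real.norm_of_nonneg ht.le, mul_inv,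
    norm_mul, norm_inv, norm_pow]
  calc t ^ p * ((‖b n‖ ^ p)⁻¹ * ‖((t : ℂ) + b n)⁻¹‖)
      ≤ t ^ p * ((‖b n‖ ^ p)⁻¹ * (κ⁻¹ * (‖b n‖ + t)⁻¹)) := by gcongr
    _ ≤ t ^ p * ((‖b n‖ ^ p)⁻¹ * (κ⁻¹ * (t ^ ((p : ℝ) + 1 - σ) * ‖b n‖ ^ (σ - p))⁻¹)) := by
        gcongr
    _ = κ⁻¹ * t ^ (σ - 1) * ‖b n‖ ^ (-σ) := by
        have e1 : t ^ ((p : ℝ) + 1 - σ) = t ^ p * (t ^ (σ - 1))⁻¹ := by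
          rw [← Real.rpow_natCast, ← Real.rpow_neg ht.le, ← Real.rpow_add ht]
          ring_nf
        have e2 : ‖b n‖ ^ (σ - p) = ‖b n‖ ^ σ * (‖b n‖ ^ p)⁻¹ := by
          rw [Real.rpow_sub hb0, Real.rpow_natCast, div_eq_mul_inv]
        rw [e1, e2, Real.rpow_neg hb0.le]
        have := Real.rpow_pos_of_pos ht (σ - 1)
        have := Real.rpow_pos_of_pos hb0 σ
        field_simp

theorem norm_stieltjesSum_le (hb : IsStieltjesSequence b α κ p) {t σ : ℝ} (ht : 0 < t)
    (hσ : α < σ) (hσ' : σ ≤ p + 1) :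
    ‖stieltjesSum b p t‖ ≤ κ⁻¹ * (∑' n, ‖b n‖ ^ (-σ)) * t ^ (σ - 1) := by
  have h := tsum_of_norm_bounded ((hb.summable σ hσ).hasSum.mul_left (κ⁻¹ * t ^ (σ - 1)))
    fun n => hb.norm_term_le n ht (hb.le_exponent.trans hσ.le) hσ'
  exact h.trans (le_of_eq (by ring))

theorem continuousOn_stieltjesSum (hb : IsStieltjesSequence b α κ p) :
    ContinuousOn (stieltjesSum b p) (Ioi 0) := by
  intro t ht
  have ht : 0 < t := ht
  have hmem : Ioo 0 (t + 1) ∈ 𝓝 t := Ioo_mem_nhds ht (by linarith)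
  refine (ContinuousOn.continuousAt (s := Ioo 0 (t + 1)) ?_ hmem).continuousWithinAt
  refine continuousOn_tsum (fun n x hx => ?_)
    ((hb.summable (p + 1) hb.exponent_lt).mul_left (κ⁻¹ * (t + 1) ^ ((p : ℝ) + 1 - 1)))
    fun n x hx => (hb.norm_term_le n hx.1 (by linarith) le_rfl).trans ?_
  · have h1 := ne_zero_of_lower_bound hb.kappa_pos (hb.lower n) hx.1
    have h2 := hb.ne_zero n
    refine ContinuousAt.continuousWithinAt (ContinuousAt.mul (by fun_prop) ?_)
    exact ContinuousAt.inv₀ (by fun_prop) (mul_ne_zero (pow_ne_zero _ h2) h1)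
  · have := hb.kappa_pos
    gcongr
    · exact hx.1.le
    · simp
    · exact hx.2.le

/-- The bound on `f'` is integrated over `[δ, t]`, and then `δ → 0`. -/
theorem norm_primitive_le (hb : IsStieltjesSequence b α κ p) {f : ℝ → ℂ}
    (hf : ∀ t, 0 < t → HasDerivAt f (stieltjesSum b p t) t) (hf0 : Tendsto f (𝓝[>] 0) (𝓝 0))
    {t σ : ℝ} (ht : 0 < t) (hσ : α < σ) (hσ' : σ ≤ p + 1) :
    ‖f t‖ ≤ κ⁻¹ * (∑' n, ‖b n‖ ^ (-σ)) / σ * t ^ σ := by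
  set K := κ⁻¹ * ∑' n, ‖b n‖ ^ (-σ) with hK
  have hK0 : 0 ≤ K := by
    have := hb.kappa_pos
    exact mul_nonneg (by positivity) (tsum_nonneg fun n => by positivity)
  have hσ0 : 0 < σ := (p.cast_nonneg.trans hb.le_exponent).trans_lt hσ
  have key : ∀ δ ∈ Ioo 0 t, ‖f t‖ ≤ ‖f δ‖ + K / σ * t ^ σ := by
    intro δ hδ
    have hpos : ∀ x ∈ Icc δ t, 0 < x := fun x hx => hδ.1.trans_le hx.1
    have hBd : ∀ x, 0 < x → HasDerivAt (fun x => ‖f δ‖ + K / σ * (x ^ σ - δ ^ σ))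
        (K * x ^ (σ - 1)) x := by
      intro x hx
      have := (((Real.hasDerivAt_rpow_const (p := σ) (Or.inl hx.ne')).sub_const
        (δ ^ σ)).const_mul (K / σ)).const_add ‖f δ‖
      refine this.congr_deriv ?_
      field_simp
    have := image_norm_le_of_norm_deriv_right_le_deriv_boundary' (f := f) (a := δ) (b := t)
      (f' := stieltjesSum b p)
      (fun x hx => (hf x (hpos x hx)).continuousAt.continuousWithinAt)
      (fun x hx => (hf x (hpos x ⟨hx.1, hx.2.le⟩)).hasDerivWithinAt)
      (B := fun x => ‖f δ‖ + K / σ * (x ^ σ - δ ^ σ)) (B' := fun x => K * x ^ (σ - 1)) (by simp)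
      (fun x hx => (hBd x (hpos x hx)).continuousAt.continuousWithinAt)
      (fun x hx => (hBd x (hpos x ⟨hx.1, hx.2.le⟩)).hasDerivWithinAt)
      (fun x hx => hb.norm_stieltjesSum_le (hpos x ⟨hx.1, hx.2.le⟩) hσ hσ')
      ⟨hδ.2.le, le_rfl⟩
    refine this.trans ?_
    have h1 : 0 ≤ K / σ * δ ^ σ := by have := hδ.1; positivity
    linarith
  have hlim : Tendsto (fun δ => ‖f δ‖ + K / σ * t ^ σ) (𝓝[>] 0) (𝓝 (0 + K / σ * t ^ σ)) := by
    simpa using hf0.norm.add_const (K / σ * t ^ σ)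
  rw [zero_add] at hlim
  exact ge_of_tendsto hlim (by filter_upwards [Ioo_mem_nhdsGT ht] with δ hδ using key δ hδ)

theorem isBigO_primitive_zero (hb : IsStieltjesSequence b α κ p) {f : ℝ → ℂ}
    (hf : ∀ t, 0 < t → HasDerivAt f (stieltjesSum b p t) t) (hf0 : Tendsto f (𝓝[>] 0) (𝓝 0)) :
    f =O[𝓝[>] 0] fun t => t ^ (-(-((p : ℝ) + 1))) := by
  refine IsBigO.of_bound (κ⁻¹ * (∑' n, ‖b n‖ ^ (-((p : ℝ) + 1))) / ((p : ℝ) + 1)) ?_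
  filter_upwards [self_mem_nhdsWithin] with t ht
  have ht : 0 < t := ht
  rw [neg_neg, Real.norm_of_nonneg (by positivity)]
  exact hb.norm_primitive_le hf hf0 ht hb.exponent_lt le_rfl

theorem isBigO_primitive_atTop (hb : IsStieltjesSequence b α κ p) {f : ℝ → ℂ}
    (hf : ∀ t, 0 < t → HasDerivAt f (stieltjesSum b p t) t) (hf0 : Tendsto f (𝓝[>] 0) (𝓝 0))
    {σ : ℝ} (hσ : α < σ) (hσ' : σ ≤ p + 1) :
    f =O[atTop] fun t => t ^ (-(-σ)) := by
  refine IsBigO.of_bound (κ⁻¹ * (∑' n, ‖b n‖ ^ (-σ)) / σ) ?_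
  filter_upwards [eventually_gt_atTop 0] with t ht
  rw [neg_neg, Real.norm_of_nonneg (by positivity)]
  exact hb.norm_primitive_le hf hf0 ht hσ hσ'

theorem mellinConvergent_primitive (hb : IsStieltjesSequence b α κ p) {f : ℝ → ℂ}
    (hf : ∀ t, 0 < t → HasDerivAt f (stieltjesSum b p t) t) (hf0 : Tendsto f (𝓝[>] 0) (𝓝 0))
    {s : ℂ} (hs : α < s.re) (hs' : s.re < p + 1) : MellinConvergent f (-s) := by
  obtain ⟨σ, hσ, hσs⟩ := exists_between hs
  refine mellinConvergent_of_isBigO_rpow ?_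
    (hb.isBigO_primitive_atTop hf hf0 hσ (hσs.trans hs').le) ?_
    (hb.isBigO_primitive_zero hf hf0) ?_
  · exact ContinuousOn.locallyIntegrableOn
      (fun t ht => (hf t ht).continuousAt.continuousWithinAt) measurableSet_Ioi
  · simpa using hσs
  · rw [Complex.neg_re]; linarith

theorem mellinConvergent_stieltjesSum (hb : IsStieltjesSequence b α κ p)
    {s : ℂ} (hs : α < s.re) (hs' : s.re < p + 1) :
    MellinConvergent (stieltjesSum b p) (1 - s) := by
  obtain ⟨σ, hσ, hσs⟩ := exists_between hs
  refine mellinConvergent_of_isBigO_rpow (a := 1 - σ) (b := 1 - (p + 1))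
    (hb.continuousOn_stieltjesSum.locallyIntegrableOn measurableSet_Ioi) ?_ ?_ ?_ ?_
  · refine IsBigO.of_bound (κ⁻¹ * (∑' n, ‖b n‖ ^ (-σ))) ?_
    filter_upwards [eventually_gt_atTop 0] with t ht
    rw [neg_sub, Real.norm_of_nonneg (by positivity)]
    exact hb.norm_stieltjesSum_le ht hσ (hσs.trans hs').le
  · simpa using hσs
  · refine IsBigO.of_bound (κ⁻¹ * (∑' n, ‖b n‖ ^ (-((p : ℝ) + 1)))) ?_
    filter_upwards [self_mem_nhdsWithin] with t ht
    have ht : 0 < t := ht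
    rw [neg_sub, Real.norm_of_nonneg (by positivity)]
    exact hb.norm_stieltjesSum_le ht hb.exponent_lt le_rfl
  · simpa using hs'

/-- Integration by parts. The boundary terms vanish by `norm_primitive_le`, with `σ = p + 1 > Re s`
at `0` and some `α < σ < Re s` at infinity. -/
theorem mellin_primitive_eq (hb : IsStieltjesSequence b α κ p) {f : ℝ → ℂ}
    (hf : ∀ t, 0 < t → HasDerivAt f (stieltjesSum b p t) t) (hf0 : Tendsto f (𝓝[>] 0) (𝓝 0))
    {s : ℂ} (hs : α < s.re) (hs' : s.re < p + 1) :
    mellin f (-s) = s⁻¹ * mellin (stieltjesSum b p) (1 - s) := by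
  have hs0 : 0 < s.re := (p.cast_nonneg.trans hb.le_exponent).trans_lt hs
  have hsne : s ≠ 0 := fun h => by simp [h] at hs0
  have hv : ∀ t ∈ Ioi (0 : ℝ), HasDerivAt (fun t : ℝ => (t : ℂ) ^ (-s) / (-s))
      ((t : ℂ) ^ (-s - 1)) t := by
    intro t ht
    have := hasDerivAt_ofReal_cpow_const' (x := t) (r := -s - 1) (ne_of_gt ht) (by
      intro h; apply hsne; linear_combination -h)
    simpa using this
  have hbound : ∀ σ : ℝ, α < σ → σ ≤ p + 1 → ∀ t : ℝ, 0 < t →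
      ‖f t * ((t : ℂ) ^ (-s) / (-s))‖
        ≤ κ⁻¹ * (∑' n, ‖b n‖ ^ (-σ)) / σ / ‖s‖ * t ^ (σ - s.re) := by
    intro σ hσ hσ' t ht
    rw [norm_mul, norm_div, norm_neg, Complex.norm_cpow_eq_rpow_re_of_pos ht, Complex.neg_re,
      Real.rpow_sub ht, Real.rpow_neg ht.le]
    have := hb.norm_primitive_le hf hf0 ht hσ hσ'
    calc _ ≤ κ⁻¹ * (∑' n, ‖b n‖ ^ (-σ)) / σ * t ^ σ * ((t ^ s.re)⁻¹ / ‖s‖) := by gcongr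
      _ = _ := by ring
  have h0 : Tendsto (f * fun t : ℝ => (t : ℂ) ^ (-s) / (-s)) (𝓝[>] 0) (𝓝 0) := by
    refine squeeze_zero_norm' (a := fun t => κ⁻¹ * (∑' n, ‖b n‖ ^ (-((p : ℝ) + 1))) /
      ((p : ℝ) + 1) / ‖s‖ * t ^ ((p : ℝ) + 1 - s.re)) ?_ ?_
    · filter_upwards [self_mem_nhdsWithin] with t ht
      exact hbound _ hb.exponent_lt le_rfl t ht
    · have h1 : 0 < (p : ℝ) + 1 - s.re := by linarith
      have := (Real.continuousAt_rpow_const 0 ((p : ℝ) + 1 - s.re) (Or.inr h1.le)).tendsto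
      rw [Real.zero_rpow h1.ne'] at this
      simpa using (this.mono_left nhdsWithin_le_nhds).const_mul _
  obtain ⟨σ, hσ, hσs⟩ := exists_between hs
  have hinf : Tendsto (f * fun t : ℝ => (t : ℂ) ^ (-s) / (-s)) atTop (𝓝 0) := by
    refine squeeze_zero_norm' (a := fun t => κ⁻¹ * (∑' n, ‖b n‖ ^ (-σ)) /
      σ / ‖s‖ * t ^ (σ - s.re)) ?_ ?_
    · filter_upwards [eventually_gt_atTop 0] with t ht
      exact hbound _ hσ (hσs.trans hs').le t ht
    · have := tendsto_rpow_neg_atTop (y := s.re - σ) (by linarith)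
      rw [neg_sub] at this
      simpa using this.const_mul _
  have hc1 := hb.mellinConvergent_primitive hf hf0 hs hs'
  have hc2 := hb.mellinConvergent_stieltjesSum hs hs'
  rw [MellinConvergent] at hc1 hc2
  have e2 : ∀ t : ℝ, (t : ℂ) ^ (1 - s - 1) = (t : ℂ) ^ (-s) := fun t => by ring_nf
  simp only [smul_eq_mul, e2] at hc1 hc2
  have key := integral_Ioi_mul_deriv_eq_deriv_mul (u := f) (u' := stieltjesSum b p)
    (fun t ht => hf t ht) hv
    (hc1.congr_fun (fun t _ => by simp [mul_comm]) measurableSet_Ioi)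
    (IntegrableOn.congr_fun (hc2.const_mul (-s)⁻¹)
      (fun t _ => by simp only [Pi.mul_apply]; ring) measurableSet_Ioi) h0 hinf
  rw [sub_zero, zero_sub] at key
  simp only [mellin, smul_eq_mul, e2]
  calc ∫ t : ℝ in Ioi 0, (t : ℂ) ^ (-s - 1) * f t
      = ∫ t : ℝ in Ioi 0, f t * (t : ℂ) ^ (-s - 1) := by simp_rw [mul_comm]
    _ = _ := by
      rw [key, ← integral_neg, ← integral_const_mul]
      refine integral_congr_ae (Eventually.of_forall fun t => ?_)
      simp only
      field_simp

/-- Collecting the powers of `t` gives the basic integral with `c = p + 1 - s` in the strip `0 < Re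
c < 1`. The sign `(-1)^p` cancels against the one in `sin πc = (-1)^p sin πs`. -/
theorem integral_term (hb : IsStieltjesSequence b α κ p) (n : ℕ)
    {s : ℂ} (hs : p < s.re) (hs' : s.re < p + 1) :
    IntegrableOn (fun t : ℝ => (t : ℂ) ^ (1 - s - 1) *
        ((-(t : ℂ)) ^ p * (b n ^ p * ((t : ℂ) + b n))⁻¹)) (Ioi 0) ∧
      ∫ t : ℝ in Ioi 0, (t : ℂ) ^ (1 - s - 1) *
        ((-(t : ℂ)) ^ p * (b n ^ p * ((t : ℂ) + b n))⁻¹)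
        = b n ^ (-s) * ((Real.pi : ℂ) / Complex.sin (Real.pi * s)) := by
  have hc0 : 0 < ((p : ℂ) + 1 - s).re := by simpa using hs'
  have hc1 : ((p : ℂ) + 1 - s).re < 1 := by simp; linarith
  have hfun : EqOn (fun t : ℝ => (-1) ^ p * (b n ^ p)⁻¹ *
      ((t : ℂ) ^ ((p : ℂ) + 1 - s - 1) * ((t : ℂ) + b n)⁻¹))
      (fun t : ℝ => (t : ℂ) ^ (1 - s - 1) *
        ((-(t : ℂ)) ^ p * (b n ^ p * ((t : ℂ) + b n))⁻¹)) (Ioi 0) := by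
    intro t ht
    have ht : (t : ℂ) ≠ 0 := by exact_mod_cast ne_of_gt ht
    simp only
    rw [show (p : ℂ) + 1 - s - 1 = (1 - s - 1) + p by ring, Complex.cpow_add _ _ ht,
      Complex.cpow_natCast, neg_pow (t : ℂ), mul_inv]
    ring
  have hslit := hb.mem_slitPlane n
  refine ⟨IntegrableOn.congr_fun ((integrableOn_cpow_mul_inv_add hslit hc0 hc1).const_mul _) hfun
    measurableSet_Ioi, ?_⟩
  rw [← setIntegral_congr_fun measurableSet_Ioi hfun, integral_const_mul,
    integral_cpow_mul_inv_add hslit hc0 hc1]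
  have hsin : Complex.sin (Real.pi * ((p : ℂ) + 1 - s)) = (-1) ^ p * Complex.sin (Real.pi * s) := by
    have := Complex.sin_antiperiodic.nat_mul_sub_eq (x := Real.pi * s) (p + 1)
    rw [show (Real.pi : ℂ) * ((p : ℂ) + 1 - s) = ((p + 1 : ℕ) : ℂ) * Real.pi - Real.pi * s by
      push_cast; ring, this, Complex.sin_neg, pow_succ]
    ring
  rw [hsin, show (p : ℂ) + 1 - s - 1 = -s + p by ring, Complex.cpow_add _ _ (hb.ne_zero n),
    Complex.cpow_natCast]
  have h1 : b n ^ p ≠ 0 := pow_ne_zero _ (hb.ne_zero n)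
  have h2 : ((-1 : ℂ) ^ p) ≠ 0 := pow_ne_zero _ (by norm_num)
  field_simp

/-- Replacing `b n` by `‖b n‖` gives a positive integrand whose integral is explicit, with a
constant independent of `n`. This justifies interchanging sum and integral in `mellin_stieltjesSum`.
-/
theorem integral_norm_term_le (hb : IsStieltjesSequence b α κ p) (n : ℕ)
    {s : ℂ} (hs : p < s.re) (hs' : s.re < p + 1) :
    ∫ t : ℝ in Ioi 0, ‖(t : ℂ) ^ (1 - s - 1) *
        ((-(t : ℂ)) ^ p * (b n ^ p * ((t : ℂ) + b n))⁻¹)‖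
      ≤ κ⁻¹ * ‖(Real.pi : ℂ) / Complex.sin (Real.pi * ((p : ℂ) + 1 - s.re))‖
        * ‖b n‖ ^ (-s.re) := by
  have hκ := hb.kappa_pos
  have hb0 : 0 < ‖b n‖ := norm_pos_iff.2 (hb.ne_zero n)
  have hbpos : ((‖b n‖ : ℝ) : ℂ) ∈ Complex.slitPlane := Complex.ofReal_mem_slitPlane.2 hb0
  set c : ℂ := (p : ℂ) + 1 - s.re with hc
  have hcre : c.re = p + 1 - s.re := by simp [hc]
  have hc0 : 0 < c.re := by linarith
  have hc1 : c.re < 1 := by linarith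
  have hint := integrableOn_cpow_mul_inv_add hbpos hc0 hc1
  have hval := integral_cpow_mul_inv_add hbpos hc0 hc1
  have hcc : c = ((p + 1 - s.re : ℝ) : ℂ) := by simp [hc]
  have hreal : ∀ t ∈ Ioi (0 : ℝ), (t : ℂ) ^ (c - 1) * ((t : ℂ) + ((‖b n‖ : ℝ) : ℂ))⁻¹
      = ((‖(t : ℂ) ^ (c - 1) * ((t : ℂ) + ((‖b n‖ : ℝ) : ℂ))⁻¹‖ : ℝ) : ℂ) := by
    intro t ht
    have ht : 0 < t := ht
    have e : (t : ℂ) ^ (c - 1) * ((t : ℂ) + ((‖b n‖ : ℝ) : ℂ))⁻¹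
        = ((t ^ ((p : ℝ) + 1 - s.re - 1) * (t + ‖b n‖)⁻¹ : ℝ) : ℂ) := by
      rw [hcc, ← Complex.ofReal_one, ← Complex.ofReal_sub, ← Complex.ofReal_cpow ht.le]
      push_cast
      rfl
    rw [e, Complex.norm_real, Real.norm_of_nonneg (by positivity)]
  have hnorm : ∫ t : ℝ in Ioi 0, ‖(t : ℂ) ^ (c - 1) * ((t : ℂ) + ((‖b n‖ : ℝ) : ℂ))⁻¹‖
      = ‖b n‖ ^ ((p : ℝ) - s.re) * ‖(Real.pi : ℂ) / Complex.sin (Real.pi * c)‖ := by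
    have h1 := setIntegral_congr_fun (μ := volume) measurableSet_Ioi hreal
    rw [hval, integral_complex_ofReal] at h1
    have h2 := congrArg norm h1
    rw [Complex.norm_real, Real.norm_of_nonneg (integral_nonneg fun t => norm_nonneg _), norm_mul,
      Complex.norm_cpow_eq_rpow_re_of_pos hb0] at h2
    rw [← h2]
    congr 2
    simp only [Complex.sub_re, Complex.one_re, hcre]
    ring
  calc ∫ t : ℝ in Ioi 0, ‖(t : ℂ) ^ (1 - s - 1) *
        ((-(t : ℂ)) ^ p * (b n ^ p * ((t : ℂ) + b n))⁻¹)‖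
      ≤ ∫ t : ℝ in Ioi 0, κ⁻¹ * (‖b n‖ ^ p)⁻¹ *
          ‖(t : ℂ) ^ (c - 1) * ((t : ℂ) + ((‖b n‖ : ℝ) : ℂ))⁻¹‖ := by
        refine setIntegral_mono_on (hb.integral_term n hs hs').1.norm (hint.norm.const_mul _)
          measurableSet_Ioi fun t ht => ?_
        have ht : 0 < t := ht
        have h1 := norm_inv_add_le hκ (hb.lower n) ht
        have e1 : ‖(t : ℂ) + ((‖b n‖ : ℝ) : ℂ)‖ = ‖b n‖ + t := by
          rw [← Complex.ofReal_add, Complex.norm_real, Real.norm_of_nonneg (by positivity),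
            add_comm]
        rw [norm_mul, norm_mul, norm_mul, norm_inv ((t : ℂ) + _), e1, norm_pow, norm_neg,
          Complex.norm_real, Real.norm_of_nonneg ht.le, mul_inv, norm_mul, norm_inv, norm_pow,
          Complex.norm_cpow_eq_rpow_re_of_pos ht, Complex.norm_cpow_eq_rpow_re_of_pos ht]
        have e2 : t ^ (c - 1).re = t ^ (1 - s - 1).re * t ^ p := by
          rw [← Real.rpow_natCast, ← Real.rpow_add ht]
          congr 1
          simp [hcre]
          ring
        rw [e2]
        calc _ ≤ t ^ (1 - s - 1).re * (t ^ p * ((‖b n‖ ^ p)⁻¹ * (κ⁻¹ * (‖b n‖ + t)⁻¹))) := by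
              gcongr
          _ = _ := by ring
    _ = _ := by
        rw [integral_const_mul, hnorm, Real.rpow_sub hb0, Real.rpow_neg hb0.le, Real.rpow_natCast]
        field_simp

theorem mellin_stieltjesSum (hb : IsStieltjesSequence b α κ p)
    {s : ℂ} (hs : α < s.re) (hs' : s.re < p + 1) :
    mellin (stieltjesSum b p) (1 - s)
      = (Real.pi : ℂ) / Complex.sin (Real.pi * s) * ∑' n, b n ^ (-s) := by
  have hps : (p : ℝ) < s.re := hb.le_exponent.trans_lt hs
  have hsum := hasSum_integral_of_summable_integral_norm (μ := volume.restrict (Ioi (0 : ℝ)))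
    (F := fun n (t : ℝ) => (t : ℂ) ^ (1 - s - 1) *
      ((-(t : ℂ)) ^ p * (b n ^ p * ((t : ℂ) + b n))⁻¹))
    (fun n => (hb.integral_term n hps hs').1)
    (Summable.of_nonneg_of_le (fun n => integral_nonneg fun t => norm_nonneg _)
      (fun n => hb.integral_norm_term_le n hps hs') ((hb.summable s.re hs).mul_left _))
  rw [← tsum_mul_left]
  have h1 := hsum.tsum_eq
  simp_rw [fun n => (hb.integral_term n hps hs').2] at h1
  rw [mellin, show (∑' n, (Real.pi : ℂ) / Complex.sin (Real.pi * s) * b n ^ (-s))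
    = ∑' n, b n ^ (-s) * ((Real.pi : ℂ) / Complex.sin (Real.pi * s)) by simp_rw [mul_comm], h1]
  refine setIntegral_congr_fun measurableSet_Ioi fun t ht => ?_
  simp only [smul_eq_mul, stieltjesSum, tsum_mul_left]

theorem summable_cpow (hb : IsStieltjesSequence b α κ p) {s : ℂ} (hs : α < s.re) :
    Summable fun n => b n ^ (-s) := by
  refine Summable.of_norm_bounded
    ((hb.summable s.re hs).mul_left (Real.exp (Real.pi * |s.im|))) fun n => ?_
  rw [Complex.norm_cpow_of_ne_zero (hb.ne_zero n), Complex.neg_re, Complex.neg_im, div_eq_mul_inv,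
    mul_comm, ← Real.exp_neg]
  gcongr
  calc -((b n).arg * -s.im) = (b n).arg * s.im := by ring
    _ ≤ |(b n).arg * s.im| := le_abs_self _
    _ = |(b n).arg| * |s.im| := abs_mul _ _
    _ ≤ Real.pi * |s.im| := by gcongr; exact Complex.abs_arg_le_pi _

theorem differentiableOn_tsum_cpow (hb : IsStieltjesSequence b α κ p) :
    DifferentiableOn ℂ (fun s : ℂ => ∑' n, b n ^ (-s)) {s : ℂ | α < s.re} := by
  intro s hs
  have hs : α < s.re := hs
  obtain ⟨σ, hσ, hσs⟩ := exists_between hs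
  have hU : IsOpen {w : ℂ | σ < w.re ∧ w.re < s.re + 1 ∧ |w.im| < |s.im| + 1} :=
    (isOpen_lt continuous_const Complex.continuous_re).inter
      ((isOpen_lt Complex.continuous_re continuous_const).inter
        (isOpen_lt Complex.continuous_im.abs continuous_const))
  -- Two powers are summed because the dominating one depends on whether `‖b n‖ ≥ 1`; the
  -- exponential bounds the contribution of the argument.
  refine ((Complex.differentiableOn_tsum_of_summable_norm (u := fun n =>
    Real.exp (Real.pi * (|s.im| + 1)) * (‖b n‖ ^ (-σ) + ‖b n‖ ^ (-(s.re + 1))))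
    (((hb.summable σ hσ).add (hb.summable (s.re + 1) (by linarith))).mul_left _) ?_ hU ?_).differentiableAt
    (hU.mem_nhds ⟨hσs, by linarith, by linarith⟩)).differentiableWithinAt
  · intro n w _
    exact (DifferentiableAt.const_cpow (by fun_prop) (Or.inl (hb.ne_zero n))).differentiableWithinAt
  · intro n w ⟨hw1, hw2, hw3⟩
    have hb0 : 0 < ‖b n‖ := norm_pos_iff.2 (hb.ne_zero n)
    rw [Complex.norm_cpow_of_ne_zero (hb.ne_zero n), Complex.neg_re, Complex.neg_im,
      div_eq_mul_inv, mul_comm, ← Real.exp_neg]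
    refine mul_le_mul (Real.exp_le_exp.2 ?_) ?_ (by positivity) (by positivity)
    · calc -((b n).arg * -w.im) = (b n).arg * w.im := by ring
        _ ≤ |(b n).arg * w.im| := le_abs_self _
        _ = |(b n).arg| * |w.im| := abs_mul _ _
        _ ≤ Real.pi * (|s.im| + 1) := by gcongr; exact Complex.abs_arg_le_pi _
    · have p1 := Real.rpow_nonneg hb0.le (-σ)
      have p2 := Real.rpow_nonneg hb0.le (-(s.re + 1))
      rcases le_total 1 ‖b n‖ with h | h
      · have := Real.rpow_le_rpow_of_exponent_le h (show -w.re ≤ -σ by linarith)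
        linarith
      · have := Real.rpow_le_rpow_of_exponent_ge hb0 h (show -(s.re + 1) ≤ -w.re by linarith)
        linarith

end IsStieltjesSequence

/-! ### Continuation of Mellin transforms from expansions at infinity. -/

theorem locallyIntegrableOn_indicator {f : ℝ → ℂ} (hf : ContinuousOn f (Ioi 0)) {s : Set ℝ}
    (hs : MeasurableSet s) : LocallyIntegrableOn (s.indicator f) (Ioi 0) := by
  intro x hx
  obtain ⟨u, hu, hui⟩ := (hf.locallyIntegrableOn (μ := volume) measurableSet_Ioi) x hx
  exact ⟨u, hu, hui.indicator hs⟩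

theorem indicator_Ioi_one_isBigO_zero (f : ℝ → ℂ) (b : ℝ) :
    (Ioi (1 : ℝ)).indicator f =O[𝓝[>] 0] fun t : ℝ => t ^ (-b) := by
  refine IsBigO.of_bound 0 ?_
  filter_upwards [Ioo_mem_nhdsGT (zero_lt_one' ℝ)] with t ht
  rw [indicator_of_notMem (fun h : t ∈ Ioi 1 => lt_asymm ht.2 h)]
  simp

theorem indicator_Ioi_one_isBigO_atTop {f : ℝ → ℂ} {g : ℝ → ℝ} (h : f =O[atTop] g) :
    (Ioi (1 : ℝ)).indicator f =O[atTop] g := by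
  refine h.congr' ?_ EventuallyEq.rfl
  filter_upwards [eventually_gt_atTop 1] with t ht
  rw [indicator_of_mem (show t ∈ Ioi 1 from ht)]

theorem continuousOn_ofReal_cpow (w : ℂ) : ContinuousOn (fun t : ℝ => (t : ℂ) ^ w) (Ioi 0) :=
  fun t ht => (Complex.continuousAt_ofReal_cpow_const t w
    (Or.inr (ne_of_gt ht))).continuousWithinAt

theorem ofReal_cpow_isBigO (w : ℝ) :
    (fun t : ℝ => (t : ℂ) ^ (w : ℂ)) =O[atTop] fun t : ℝ => t ^ (-(-w)) := by
  refine IsBigO.of_bound 1 ?_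
  filter_upwards [eventually_gt_atTop 0] with t ht
  rw [Complex.norm_cpow_eq_rpow_re_of_pos ht, Complex.ofReal_re, neg_neg, one_mul,
    Real.norm_of_nonneg (by positivity)]

theorem mellin_indicator_cpow (w : ℝ) {z : ℂ} (hz : z.re < -w) :
    mellin ((Ioi (1 : ℝ)).indicator fun t : ℝ => (t : ℂ) ^ (w : ℂ)) z = -1 / (z + w) := by
  have hne : z + w ≠ 0 := fun h => by
    have := congrArg Complex.re h
    simp at this
    linarith
  have h1 : ((z : ℂ) - 1 + w).re < -1 := by simp; linarith
  have h2 := integral_Ioi_cpow_of_lt h1 (zero_lt_one' ℝ)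
  rw [Complex.ofReal_one, Complex.one_cpow, show z - 1 + w + 1 = z + w by ring] at h2
  rw [← h2, mellin, ← integral_indicator measurableSet_Ioi, ← integral_indicator measurableSet_Ioi]
  congr 1
  ext t
  by_cases ht : t ∈ Ioi (1 : ℝ)
  · have ht0 : (0 : ℝ) < t := lt_trans one_pos ht
    rw [indicator_of_mem (show t ∈ Ioi 0 from ht0), indicator_of_mem ht, indicator_of_mem ht,
      smul_eq_mul, Complex.cpow_add _ _ (by exact_mod_cast ht0.ne')]
  · rw [indicator_of_notMem ht]
    by_cases ht0 : t ∈ Ioi (0 : ℝ)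
    · rw [indicator_of_mem ht0, indicator_of_notMem ht, smul_zero]
    · rw [indicator_of_notMem ht0]

/-- The logarithm is produced by differentiating the Mellin transform of the truncated power in its
variable, which turns the simple pole into a double one. -/
theorem hasMellin_indicator_cpow_log (w : ℝ) (A B : ℂ) {s : ℂ} (hs : w < s.re) :
    HasMellin ((Ioi (1 : ℝ)).indicator fun t : ℝ => (A + B * Real.log t) * (t : ℂ) ^ (w : ℂ)) (-s)
      (A / (s - w) + B / (s - w) ^ 2) := by
  set g := (Ioi (1 : ℝ)).indicator fun t : ℝ => (t : ℂ) ^ (w : ℂ) with hg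
  have hre : (-s).re < -w := by simpa using hs
  have hne : s - w ≠ 0 := fun h => by
    have := congrArg Complex.re h
    simp at this
    linarith
  have hloc := locallyIntegrableOn_indicator (continuousOn_ofReal_cpow w)
    (measurableSet_Ioi (a := (1 : ℝ)))
  have htop := indicator_Ioi_one_isBigO_atTop (ofReal_cpow_isBigO w)
  have hzero := indicator_Ioi_one_isBigO_zero (fun t : ℝ => (t : ℂ) ^ (w : ℂ)) ((-s).re - 1)
  have hconv : MellinConvergent g (-s) :=
    mellinConvergent_of_isBigO_rpow hloc htop hre hzero (by linarith)
  have hder := mellin_hasDerivAt_of_isBigO_rpow hloc htop hre hzero (by linarith)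
  have hval : mellin g (-s) = 1 / (s - w) := by
    rw [mellin_indicator_cpow w hre, show -s + (w : ℂ) = -(s - w) by ring, neg_div_neg_eq]
  have hne' : -s + (w : ℂ) ≠ 0 := by
    rw [show -s + (w : ℂ) = -(s - w) by ring]
    exact neg_ne_zero.2 hne
  have hlog : mellin (fun t => (Real.log t : ℝ) • g t) (-s) = 1 / (s - w) ^ 2 := by
    have hev : mellin g =ᶠ[𝓝 (-s)] fun z => -1 / (z + w) := by
      filter_upwards [(isOpen_lt Complex.continuous_re continuous_const).mem_nhds hre] with z hz
      exact mellin_indicator_cpow w hz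
    have h1 : HasDerivAt (fun z : ℂ => -1 / (z + w)) (1 / (s - w) ^ 2) (-s) := by
      have := (((hasDerivAt_id (-s)).add_const (w : ℂ)).fun_inv hne').neg
      refine (this.congr_deriv ?_).congr_of_eventuallyEq
        (Eventually.of_forall fun z => by simp [div_eq_mul_inv])
      simp only [id]
      rw [show -s + (w : ℂ) = -(s - w) by ring]
      field_simp
    exact hder.2.unique (h1.congr_of_eventuallyEq hev)
  have hadd := hasMellin_add (hconv.const_smul A) (hder.1.const_smul B)
  rw [mellin_const_smul, mellin_const_smul, hval, hlog] at hadd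
  have hfun : (fun t => A • g t + B • (Real.log t : ℝ) • g t)
      = (Ioi (1 : ℝ)).indicator fun t : ℝ => (A + B * Real.log t) * (t : ℂ) ^ (w : ℂ) := by
    ext t
    by_cases ht : t ∈ Ioi (1 : ℝ)
    · simp only [hg, indicator_of_mem ht, smul_eq_mul, Complex.real_smul]
      ring
    · simp only [hg, indicator_of_notMem ht, smul_zero, add_zero]
  rw [hfun] at hadd
  convert hadd using 1
  simp only [smul_eq_mul]
  ring

/-- Split at `t = 1`: `f` on `(0,1]` has a transform holomorphic for `Re s < c`, the remainder `r`
on `(1,∞)` one holomorphic for `Re s > β`, and the explicit terms on `(1,∞)` give the poles. The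
factor `s^2` clears the double pole at `0`. -/
theorem exists_mellin_continuation {ι : Type*} {f r : ℝ → ℂ} {K : Finset ι} {A B : ι → ℂ}
    {w : ι → ℝ} {α β c : ℝ} (hβ : β < 0) (hα : 0 ≤ α) (hαc : α < c)
    (hf : ContinuousOn f (Ioi 0)) (hr : ContinuousOn r (Ioi 0))
    (hf0 : f =O[𝓝[>] 0] fun t : ℝ => t ^ (-(-c))) (hrO : r =O[atTop] fun t : ℝ => t ^ (-(-β)))
    (hfr : ∀ t, 0 < t →
      f t = ∑ k ∈ K, (A k + B k * Real.log t) * (t : ℂ) ^ (w k : ℂ) + r t)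
    (hw : ∀ k ∈ K, w k ≤ α) :
    ∃ P : ℂ → ℂ, MeromorphicOn P {s : ℂ | β < s.re ∧ s.re < c} ∧ AnalyticAt ℂ P 0 ∧
      P 0 = (∑ k ∈ K, if w k = 0 then B k else 0) ∧
      deriv P 0 = (∑ k ∈ K, if w k = 0 then A k else 0) ∧
      ∀ s : ℂ, α < s.re → s.re < c → P s = s ^ 2 * mellin f (-s) := by
  set f₁ := (Ioc (0 : ℝ) 1).indicator f with hf₁
  set r₁ := (Ioi (1 : ℝ)).indicator r with hr₁
  set U := {s : ℂ | β < s.re ∧ s.re < c} with hU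
  have hUo : IsOpen U := (isOpen_lt continuous_const Complex.continuous_re).inter
    (isOpen_lt Complex.continuous_re continuous_const)
  have h0U : (0 : ℂ) ∈ U := ⟨by simpa using hβ, by simp; linarith⟩
  have hf₁loc := locallyIntegrableOn_indicator hf (measurableSet_Ioc (a := (0 : ℝ)) (b := 1))
  have hr₁loc := locallyIntegrableOn_indicator hr (measurableSet_Ioi (a := (1 : ℝ)))
  have hf₁top : ∀ b : ℝ, f₁ =O[atTop] fun t : ℝ => t ^ (-b) := by
    intro b
    refine IsBigO.of_bound 0 ?_
    filter_upwards [eventually_gt_atTop 1] with t ht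
    rw [hf₁, indicator_of_notMem (fun h : t ∈ Ioc 0 1 => not_lt.2 h.2 ht)]
    simp
  have hf₁zero : f₁ =O[𝓝[>] 0] fun t : ℝ => t ^ (-(-c)) := by
    refine hf0.congr' ?_ EventuallyEq.rfl
    filter_upwards [Ioo_mem_nhdsGT (zero_lt_one' ℝ)] with t ht
    rw [hf₁, indicator_of_mem (show t ∈ Ioc 0 1 from ⟨ht.1, ht.2.le⟩)]
  have hr₁top := indicator_Ioi_one_isBigO_atTop hrO
  have hr₁zero := fun b => indicator_Ioi_one_isBigO_zero r b
  have hfc : ∀ s : ℂ, s.re < c → MellinConvergent f₁ (-s) ∧ DifferentiableAt ℂ (mellin f₁) (-s) := by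
    intro s hs
    have hs' : -c < (-s).re := by simpa using hs
    exact ⟨mellinConvergent_of_isBigO_rpow hf₁loc (hf₁top ((-s).re + 1)) (by linarith) hf₁zero hs',
      mellin_differentiableAt_of_isBigO_rpow hf₁loc (hf₁top ((-s).re + 1)) (by linarith)
        hf₁zero hs'⟩
  have hrc : ∀ s : ℂ, β < s.re → MellinConvergent r₁ (-s) ∧ DifferentiableAt ℂ (mellin r₁) (-s) := by
    intro s hs
    have hs' : (-s).re < -β := by simpa using hs
    exact ⟨mellinConvergent_of_isBigO_rpow hr₁loc hr₁top hs' (hr₁zero ((-s).re - 1)) (by linarith),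
      mellin_differentiableAt_of_isBigO_rpow hr₁loc hr₁top hs' (hr₁zero ((-s).re - 1))
        (by linarith)⟩
  set H : ℂ → ℂ := fun s => mellin f₁ (-s) + mellin r₁ (-s) with hH
  have hHd : DifferentiableOn ℂ H U := by
    intro s hs
    have h1 : DifferentiableAt ℂ (fun s => mellin f₁ (-s)) s :=
      DifferentiableAt.comp (g := mellin f₁) (f := fun s => -s) s (hfc s hs.2).2 differentiableAt_id.neg
    have h2 : DifferentiableAt ℂ (fun s => mellin r₁ (-s)) s :=
      DifferentiableAt.comp (g := mellin r₁) (f := fun s => -s) s (hrc s hs.1).2 differentiableAt_id.neg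
    exact (h1.add h2).differentiableWithinAt
  have hHan : ∀ s ∈ U, AnalyticAt ℂ H s := fun s hs => hHd.analyticAt (hUo.mem_nhds hs)
  -- `E` omits the poles at `0`; multiplied by `s^2`, these become the affine function `D`, which
  -- alone determines the value and the derivative of `s^2 E + D` at `0`.
  set E : ℂ → ℂ := fun s => H s + ∑ k ∈ K,
    if w k = 0 then 0 else A k / (s - w k) + B k / (s - w k) ^ 2 with hE
  set D : ℂ → ℂ := fun s => ∑ k ∈ K, if w k = 0 then A k * s + B k else 0 with hD
  have hE0 : AnalyticAt ℂ E 0 := by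
    refine (hHan 0 h0U).add (Finset.analyticAt_fun_sum K fun k _ => ?_)
    by_cases hk : w k = 0
    · simp only [hk, if_true]
      exact analyticAt_const
    · simp only [hk, if_false]
      have hk' : (0 : ℂ) - w k ≠ 0 := by simpa using hk
      refine AnalyticAt.add ?_ ?_
      · exact AnalyticAt.div analyticAt_const (by fun_prop) hk'
      · exact AnalyticAt.div analyticAt_const (by fun_prop) (pow_ne_zero 2 hk')
  have hDd : ∀ s, HasDerivAt D (∑ k ∈ K, if w k = 0 then A k else 0) s := by
    intro s
    refine HasDerivAt.fun_sum fun k _ => ?_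
    by_cases hk : w k = 0
    · simp only [hk, if_true]
      simpa using ((hasDerivAt_id s).const_mul (A k)).add_const (B k)
    · simp only [hk, if_false]
      exact hasDerivAt_const _ _
  have hDan : ∀ s, AnalyticAt ℂ D s := fun s =>
    Differentiable.analyticAt (fun z => (hDd z).differentiableAt) s
  refine ⟨fun s => s ^ 2 * E s + D s, fun s hs => ?_, ?_, ?_, ?_, fun s hs hsc => ?_⟩
  · have hEm : MeromorphicAt E s := by
      refine (hHan s hs).meromorphicAt.add (MeromorphicAt.fun_sum fun k _ => ?_)
      by_cases hk : w k = 0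
      · simp only [hk, if_true]
        exact MeromorphicAt.const _ _
      · simp only [hk, if_false]
        fun_prop
    exact (MeromorphicAt.mul (by fun_prop) hEm).add (hDan s).meromorphicAt
  · exact AnalyticAt.add (AnalyticAt.mul (by fun_prop) hE0) (hDan 0)
  · simp [hD]
  · have h1 := (((hasDerivAt_id (0 : ℂ)).fun_pow 2).mul hE0.differentiableAt.hasDerivAt).add (hDd 0)
    exact h1.deriv.trans (by simp)
  · have hs0 : s ≠ 0 := fun h => by
      rw [h, Complex.zero_re] at hs
      linarith
    have hterm := fun k (hk : k ∈ K) =>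
      hasMellin_indicator_cpow_log (w k) (A k) (B k) ((hw k hk).trans_lt hs)
    have hsplit : mellin f (-s) = H s + ∑ k ∈ K, (A k / (s - w k) + B k / (s - w k) ^ 2) := by
      have hpt : EqOn (fun t : ℝ => (t : ℂ) ^ (-s - 1) • f t) (fun t : ℝ =>
          ((t : ℂ) ^ (-s - 1) • f₁ t + (t : ℂ) ^ (-s - 1) • r₁ t) + ∑ k ∈ K, (t : ℂ) ^ (-s - 1) •
          (Ioi (1 : ℝ)).indicator (fun t : ℝ => (A k + B k * Real.log t) * (t : ℂ) ^ (w k : ℂ)) t)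
          (Ioi 0) := by
        intro t ht
        have ht : 0 < t := ht
        simp only [← Finset.smul_sum, ← smul_add]
        congr 1
        rcases le_or_gt t 1 with h | h
        · have h' : t ∉ Ioi (1 : ℝ) := not_lt.2 h
          simp only [hf₁, hr₁, indicator_of_notMem h', indicator_of_mem
            (show t ∈ Ioc (0 : ℝ) 1 from ⟨ht, h⟩), Finset.sum_const_zero, add_zero]
        · have h' : t ∈ Ioi (1 : ℝ) := h
          simp only [hf₁, hr₁, indicator_of_mem h', indicator_of_notMem
            (fun h2 : t ∈ Ioc (0 : ℝ) 1 => not_lt.2 h2.2 h), zero_add]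
          rw [hfr t ht, add_comm]
      have c1 := (hfc s hsc).1
      have c2 := (hrc s (by linarith)).1
      have c12 : IntegrableOn (fun t : ℝ => (t : ℂ) ^ (-s - 1) • f₁ t + (t : ℂ) ^ (-s - 1) • r₁ t)
        (Ioi 0) := c1.add c2
      rw [mellin, setIntegral_congr_fun measurableSet_Ioi hpt, integral_add c12
        (integrable_finsetSum _ fun k hk => (hterm k hk).1), integral_add c1 c2,
        integral_finsetSum _ fun k hk => (hterm k hk).1]
      congr 1
      exact Finset.sum_congr rfl fun k hk => (hterm k hk).2
    have hsum : s ^ 2 * (∑ k ∈ K, (A k / (s - w k) + B k / (s - w k) ^ 2))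
        = s ^ 2 * (∑ k ∈ K, if w k = 0 then 0 else A k / (s - w k) + B k / (s - w k) ^ 2)
          + D s := by
      rw [Finset.mul_sum, Finset.mul_sum, hD, ← Finset.sum_add_distrib]
      refine Finset.sum_congr rfl fun k hk => ?_
      by_cases hk0 : w k = 0
      · simp only [hk0, if_true, Complex.ofReal_zero, sub_zero]
        field_simp
        ring
      · simp only [hk0, if_false, add_zero]
    rw [hsplit, mul_add _ (H s), hsum]
    simp only [hE]
    ring

theorem dslope_sin_neg (x : ℂ) : dslope Complex.sin 0 (-x) = dslope Complex.sin 0 x := by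
  by_cases hx : x = 0
  · simp [hx]
  · rw [dslope_of_ne _ hx, dslope_of_ne _ (neg_ne_zero.2 hx), slope_def_field, slope_def_field]
    simp

theorem differentiable_dslope_sin : Differentiable ℂ (dslope Complex.sin 0) := by
  rw [← differentiableOn_univ, Complex.differentiableOn_dslope univ_mem]
  exact Complex.differentiable_sin.differentiableOn

/-- The function `sin x / x`, extended by `1`, is even. -/
theorem deriv_dslope_sin_zero : deriv (dslope Complex.sin 0) 0 = 0 := by
  have h := deriv_comp_neg (dslope Complex.sin 0) (0 : ℂ)
  simp_rw [dslope_sin_neg, neg_zero] at h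
  exact self_eq_neg.1 h

/-- The continuation is `G = (sin πs / πs) · P` with `P` continuing `s^2 · mellin f (-s)`. The first
factor is `1` with zero derivative at `0`, so `G` inherits the value and the derivative of `P`. -/
theorem IsStieltjesSequence.exists_continuation {b : ℕ → ℂ} {α κ : ℝ} {p : ℕ}
    (hb : IsStieltjesSequence b α κ p) {ι : Type*} {f r : ℝ → ℂ} {K : Finset ι} {A B : ι → ℂ}
    {w : ι → ℝ} {β : ℝ} (hβ : β < 0)
    (hf : ∀ t, 0 < t → HasDerivAt f (stieltjesSum b p t) t) (hf0 : Tendsto f (𝓝[>] 0) (𝓝 0))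
    (hr : ContinuousOn r (Ioi 0)) (hrO : r =O[atTop] fun t : ℝ => t ^ (-(-β)))
    (hfr : ∀ t, 0 < t →
      f t = ∑ k ∈ K, (A k + B k * Real.log t) * (t : ℂ) ^ (w k : ℂ) + r t)
    (hw : ∀ k ∈ K, w k ≤ α) :
    ∃ G : ℂ → ℂ, MeromorphicOn G {s : ℂ | β < s.re ∧ s.re < p + 1} ∧ AnalyticAt ℂ G 0 ∧
      G 0 = (∑ k ∈ K, if w k = 0 then B k else 0) ∧
      deriv G 0 = (∑ k ∈ K, if w k = 0 then A k else 0) ∧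
      ∀ s : ℂ, α < s.re → s.re < p + 1 → G s = ∑' n, b n ^ (-s) := by
  have hα : 0 ≤ α := p.cast_nonneg.trans hb.le_exponent
  obtain ⟨P, hPm, hPa, hP0, hP1, hP⟩ := exists_mellin_continuation hβ hα hb.exponent_lt
    (fun t ht => (hf t ht).continuousAt.continuousWithinAt) hr (hb.isBigO_primitive_zero hf hf0)
    hrO hfr hw
  set S : ℂ → ℂ := fun s => dslope Complex.sin 0 (Real.pi * s) with hS
  have hSd : Differentiable ℂ S :=
    differentiable_dslope_sin.comp (differentiable_id.const_mul (Real.pi : ℂ))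
  have hS0 : S 0 = 1 := by simp [hS, dslope_same, Complex.cos_zero]
  have hS1 : HasDerivAt S 0 0 := by
    have h1 : HasDerivAt (dslope Complex.sin 0) 0 ((Real.pi : ℂ) * 0) := by
      have := (differentiable_dslope_sin 0).hasDerivAt
      rw [deriv_dslope_sin_zero] at this
      rwa [mul_zero]
    have h2 : HasDerivAt (fun s : ℂ => (Real.pi : ℂ) * s) Real.pi 0 := by
      simpa using (hasDerivAt_id (0 : ℂ)).const_mul (Real.pi : ℂ)
    have := HasDerivAt.comp (0 : ℂ) h1 h2
    rwa [zero_mul] at this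
  refine ⟨fun s => S s * P s, fun s hs => ((hSd.analyticAt s).meromorphicAt).mul (hPm s hs),
    (hSd.analyticAt 0).mul hPa, by simp [hS0, hP0], ?_, fun s hs hs' => ?_⟩
  · have := (hS1.mul hPa.differentiableAt.hasDerivAt).deriv
    rw [zero_mul, zero_add, hS0, one_mul, hP1] at this
    exact this
  · have hs0 : s ≠ 0 := fun h => by
      rw [h, Complex.zero_re] at hs
      linarith
    have hpi : (Real.pi : ℂ) ≠ 0 := by exact_mod_cast Real.pi_ne_zero
    -- A zero would make `s` an integer strictly between `p` and `p + 1`.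
    have hsin : Complex.sin (Real.pi * s) ≠ 0 := by
      rw [Complex.sin_ne_zero_iff]
      intro k hk
      rw [mul_comm (Real.pi : ℂ) s] at hk
      have hk' : s = k := mul_right_cancel₀ hpi hk
      rw [hk', Complex.intCast_re] at hs hs'
      have h1 : ((p : ℤ) : ℝ) < (k : ℝ) := by
        have := hb.le_exponent.trans_lt hs
        exact_mod_cast this
      have h2 : (k : ℝ) < ((p + 1 : ℤ) : ℝ) := by push_cast; exact hs'
      have h3 : (p : ℤ) < k := by exact_mod_cast h1
      have h4 : k < (p : ℤ) + 1 := by exact_mod_cast h2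
      omega
    simp only
    rw [hP s hs hs', hb.mellin_primitive_eq hf hf0 hs hs', hb.mellin_stieltjesSum hs hs', hS]
    simp only
    rw [dslope_of_ne _ (mul_ne_zero hpi hs0), slope_def_field, Complex.sin_zero]
    field_simp
    ring

/-! ### Uniqueness of the continuation. -/

/-- Infinite order of the difference propagates through the connected half-plane. Analyticity at `z`
upgrades equality on a punctured neighbourhood to a full one. -/
theorem MeromorphicOn.eventuallyEq_of_eqOn_halfPlane {Z₁ Z₂ : ℂ → ℂ} {α τ : ℝ} {z : ℂ}
    (h₁ : MeromorphicOn Z₁ {s : ℂ | τ < s.re}) (h₂ : MeromorphicOn Z₂ {s : ℂ | τ < s.re})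
    (heq : ∀ s : ℂ, α < s.re → Z₁ s = Z₂ s) (hz : τ < z.re)
    (ha₁ : AnalyticAt ℂ Z₁ z) (ha₂ : AnalyticAt ℂ Z₂ z) : Z₁ =ᶠ[𝓝 z] Z₂ := by
  have hm : MeromorphicOn (Z₁ - Z₂) {s : ℂ | τ < s.re} := h₁.sub h₂
  have hconn : IsPreconnected {s : ℂ | τ < s.re} := (convex_halfSpace_re_gt τ).isPreconnected
  set y : ℂ := ((max α τ + 1 : ℝ) : ℂ) with hy
  have hyα : α < y.re := by
    rw [hy, Complex.ofReal_re]
    linarith [le_max_left α τ]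
  have hyτ : y ∈ {s : ℂ | τ < s.re} := by
    rw [mem_ofPred_eq, hy, Complex.ofReal_re]
    linarith [le_max_right α τ]
  have hytop : meromorphicOrderAt (Z₁ - Z₂) y = ⊤ := by
    rw [meromorphicOrderAt_eq_top_iff]
    filter_upwards [nhdsWithin_le_nhds
      ((isOpen_lt continuous_const Complex.continuous_re).mem_nhds hyα)] with s hs
    simp [heq s hs]
  have hztop : meromorphicOrderAt (Z₁ - Z₂) z = ⊤ := by
    by_contra h
    exact hm.meromorphicOrderAt_ne_top_of_isPreconnected hconn hz hyτ h hytop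
  rw [meromorphicOrderAt_eq_top_iff] at hztop
  refine (ha₁.frequently_eq_iff_eventually_eq ha₂).1 (Eventually.frequently ?_)
  filter_upwards [hztop] with s hs
  exact sub_eq_zero.1 hs

/-! ### The ray, its sector and the branch of the logarithm. -/

/-- The unit vector in the direction of the ray. -/
noncomputable def rayDir (Ψ : ℝ) : ℂ := Complex.exp ((Ψ : ℂ) * Complex.I)

theorem rayDir_ne_zero (Ψ : ℝ) : rayDir Ψ ≠ 0 := Complex.exp_ne_zero _

theorem norm_rayDir (Ψ : ℝ) : ‖rayDir Ψ‖ = 1 := Complex.norm_exp_ofReal_mul_I Ψ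

theorem exp_neg_eq_inv_rayDir (Ψ : ℝ) :
    Complex.exp (-((Ψ : ℂ) * Complex.I)) = (rayDir Ψ)⁻¹ := Complex.exp_neg _

theorem rayLog_ray (Ψ : ℝ) {t : ℝ} (ht : 0 < t) :
    rayLog Ψ (t * rayDir Ψ) = Real.log t + Ψ * Complex.I := by
  rw [rayLog, exp_neg_eq_inv_rayDir, mul_assoc, mul_inv_cancel₀ (rayDir_ne_zero Ψ), mul_one,
    Complex.ofReal_log ht.le]

theorem rayPow_ray (Ψ : ℝ) {t : ℝ} (ht : 0 < t) (w : ℂ) :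
    rayPow Ψ (t * rayDir Ψ) w = Complex.exp (w * (Ψ * Complex.I)) * (t : ℂ) ^ w := by
  rw [rayPow, rayLog_ray Ψ ht, Complex.cpow_def_of_ne_zero (by exact_mod_cast ht.ne'),
    ← Complex.exp_add, Complex.ofReal_log ht.le]
  ring_nf

theorem mem_raySector_of_abs_arg_lt {Ψ ε : ℝ} {z : ℂ} (hz : z ≠ 0)
    (h : |(z * (rayDir Ψ)⁻¹).arg| < ε) : z ∈ raySector Ψ ε := by
  refine ⟨‖z‖, Ψ + (z * (rayDir Ψ)⁻¹).arg, norm_pos_iff.2 hz, by simpa using h, ?_⟩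
  have h1 := Complex.norm_mul_exp_arg_mul_I (z * (rayDir Ψ)⁻¹)
  rw [norm_mul, norm_inv, norm_rayDir, inv_one, mul_one] at h1
  rw [Complex.ofReal_add, add_mul, Complex.exp_add, mul_left_comm, h1, ← rayDir]
  field_simp [rayDir_ne_zero Ψ]

theorem raySector_mem_nhds {Ψ ε : ℝ} (hε : 0 < ε) {t : ℝ} (ht : 0 < t) :
    raySector Ψ ε ∈ 𝓝 ((t : ℂ) * rayDir Ψ) := by
  have hne : (t : ℂ) * rayDir Ψ ≠ 0 := mul_ne_zero (by exact_mod_cast ht.ne') (rayDir_ne_zero Ψ)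
  have e : (t : ℂ) * rayDir Ψ * (rayDir Ψ)⁻¹ = t := by
    rw [mul_assoc, mul_inv_cancel₀ (rayDir_ne_zero Ψ), mul_one]
  have hc : ContinuousAt (fun z : ℂ => |(z * (rayDir Ψ)⁻¹).arg|) ((t : ℂ) * rayDir Ψ) := by
    refine ContinuousAt.abs (ContinuousAt.comp (g := Complex.arg) ?_ (by fun_prop))
    rw [e]
    exact Complex.continuousAt_arg (Complex.ofReal_mem_slitPlane.2 ht)
  have hlt : |((t : ℂ) * rayDir Ψ * (rayDir Ψ)⁻¹).arg| < ε := by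
    rw [e, Complex.arg_ofReal_of_nonneg ht.le, abs_zero]
    exact hε
  filter_upwards [hc.eventually_lt continuousAt_const hlt, isOpen_ne.mem_nhds hne] with z hz hz0
  exact mem_raySector_of_abs_arg_lt hz0 hz

theorem ray_mem_raySector {Ψ ε : ℝ} (hε : 0 < ε) {t : ℝ} (ht : 0 < t) :
    (t : ℂ) * rayDir Ψ ∈ raySector Ψ ε := mem_of_mem_nhds (raySector_mem_nhds hε ht)

theorem tendsto_ray_atTop {Ψ ε : ℝ} (hε : 0 < ε) :
    Tendsto (fun t : ℝ => (t : ℂ) * rayDir Ψ) atTop (cocompact ℂ ⊓ 𝓟 (raySector Ψ ε)) := by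
  refine tendsto_inf.2 ⟨?_, tendsto_principal.2 ?_⟩
  · rw [← Metric.cobounded_eq_cocompact, ← tendsto_norm_atTop_iff_cobounded]
    simp only [norm_mul, norm_rayDir, mul_one, Complex.norm_real]
    exact tendsto_norm_atTop_atTop
  · filter_upwards [eventually_gt_atTop 0] with t ht using ray_mem_raySector hε ht

theorem tendsto_ray_zero {Ψ ε : ℝ} (hε : 0 < ε) :
    Tendsto (fun t : ℝ => (t : ℂ) * rayDir Ψ) (𝓝[>] 0) (𝓝[raySector Ψ ε] 0) := by
  refine tendsto_nhdsWithin_of_tendsto_nhds_of_eventually_within _ ?_ ?_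
  · have : Continuous fun t : ℝ => (t : ℂ) * rayDir Ψ := by fun_prop
    exact (this.tendsto' 0 0 (by simp)).mono_left nhdsWithin_le_nhds
  · filter_upwards [self_mem_nhdsWithin] with t ht using ray_mem_raySector hε ht

theorem isPreconnected_raySector_inter_ball (Ψ ε ρ : ℝ) :
    IsPreconnected (raySector Ψ ε ∩ Metric.ball 0 ρ) := by
  have hc : Continuous fun x : ℝ × ℝ => (x.1 : ℂ) * Complex.exp ((x.2 : ℂ) * Complex.I) := by
    fun_prop
  have h := ((isPreconnected_Ioo (a := (0 : ℝ)) (b := ρ)).prod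
    (isPreconnected_Ioo (a := Ψ - ε) (b := Ψ + ε))).image _ hc.continuousOn
  convert h using 1
  ext z
  constructor
  · rintro ⟨⟨r, θ, hr, hθ, rfl⟩, hz⟩
    rw [mem_ball_zero_iff, norm_mul, Complex.norm_exp_ofReal_mul_I, mul_one, Complex.norm_real,
      Real.norm_of_nonneg hr.le] at hz
    rw [abs_lt] at hθ
    exact ⟨(r, θ), ⟨⟨hr, hz⟩, ⟨by linarith, by linarith⟩⟩, rfl⟩
  · rintro ⟨⟨r, θ⟩, ⟨⟨hr, hz⟩, ⟨h1, h2⟩⟩, rfl⟩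
    simp only at hr hz h1 h2
    refine ⟨⟨r, θ, hr, abs_lt.2 ⟨by linarith, by linarith⟩, rfl⟩, ?_⟩
    rwa [mem_ball_zero_iff, norm_mul, Complex.norm_exp_ofReal_mul_I, mul_one, Complex.norm_real,
      Real.norm_of_nonneg hr.le]

/-- `(M - c)/(2πi)` is continuous with integer values, hence constant. -/
theorem IsPreconnected.eq_of_exp_eq {S : Set ℂ} (hS : IsPreconnected S) {M : ℂ → ℂ}
    (hM : ContinuousOn M S) {c : ℂ} (hc : ∀ z ∈ S, Complex.exp (M z) = Complex.exp c)
    {x y : ℂ} (hx : x ∈ S) (hy : y ∈ S) : M x = M y := by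
  have hint : ∀ z ∈ S, ∃ n : ℤ, M z = c + n * (2 * Real.pi * Complex.I) := fun z hz =>
    Complex.exp_eq_exp_iff_exists_int.1 (hc z hz)
  have hne : (2 * Real.pi * Complex.I : ℂ) ≠ 0 := Complex.two_pi_I_ne_zero
  have hre : ∀ z n, M z = c + (n : ℤ) * (2 * Real.pi * Complex.I) →
      ((M z - c) / (2 * Real.pi * Complex.I)).re = n := by
    intro z n h
    rw [h, add_sub_cancel_left, mul_div_cancel_right₀ _ hne, Complex.intCast_re]
  have hdisc : DiscreteTopology (range ((↑) : ℤ → ℝ)) :=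
    Int.isClosedEmbedding_coe_real.isEmbedding.toHomeomorph.symm.isEmbedding.discreteTopology
  have hcont : ContinuousOn (fun z => ((M z - c) / (2 * Real.pi * Complex.I)).re) S :=
    Complex.continuous_re.comp_continuousOn ((hM.sub continuousOn_const).div_const _)
  have hmaps : MapsTo (fun z => ((M z - c) / (2 * Real.pi * Complex.I)).re) S
      (range ((↑) : ℤ → ℝ)) := by
    intro z hz
    obtain ⟨n, hn⟩ := hint z hz
    exact ⟨n, (hre z n hn).symm⟩
  have hconst := hS.constant_of_mapsTo ⟨hdisc⟩ hcont hmaps hx hy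
  obtain ⟨n, hn⟩ := hint x hx
  obtain ⟨k, hk⟩ := hint y hy
  simp only [hre x n hn, hre y k hk, Int.cast_inj] at hconst
  rw [hn, hk, hconst]

/-- Near `0` the quotient `F / F 0` lies in the slit plane, and `L` differs from its principal
logarithm by a constant on the connected part of the sector near the vertex. -/
theorem IsLogBranchOn.exists_tendsto_zero {L F : ℂ → ℂ} {Ψ ε : ℝ} (hε : 0 < ε)
    (hF : Continuous F) (hF0 : F 0 ≠ 0) (hL : IsLogBranchOn L F (raySector Ψ ε)) :
    ∃ ℓ : ℂ, Tendsto L (𝓝[raySector Ψ ε] 0) (𝓝 ℓ) := by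
  have hq : Continuous fun z => F z / F 0 := hF.div_const _
  have hmem : {z | F z / F 0 ∈ Complex.slitPlane} ∈ 𝓝 (0 : ℂ) :=
    (Complex.isOpen_slitPlane.preimage hq).mem_nhds (by
      simp [div_self hF0, Complex.one_mem_slitPlane])
  obtain ⟨ρ, hρ, hball⟩ := Metric.mem_nhds_iff.1 hmem
  set V := raySector Ψ ε ∩ Metric.ball 0 ρ with hV
  have hlogc : ContinuousOn (fun z => Complex.log (F z / F 0)) (Metric.ball 0 ρ) :=
    hq.continuousOn.clog fun z hz => hball hz
  have hcont : ContinuousOn (fun z => L z - Complex.log (F z / F 0)) V :=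
    (hL.holomorphic.continuousOn.mono inter_subset_left).sub (hlogc.mono inter_subset_right)
  have hexp : ∀ z ∈ V, Complex.exp (L z - Complex.log (F z / F 0))
      = Complex.exp (Complex.log (F 0)) := by
    intro z hz
    have h1 : F z / F 0 ≠ 0 := Complex.slitPlane_ne_zero (hball hz.2)
    have h2 : F z ≠ 0 := fun h => h1 (by rw [h, zero_div])
    rw [Complex.exp_sub, hL.exp_eq z hz.1, Complex.exp_log h1, Complex.exp_log hF0]
    field_simp
  have hy : ((ρ / 2 : ℝ) : ℂ) * rayDir Ψ ∈ V := by
    refine ⟨ray_mem_raySector hε (by positivity), ?_⟩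
    rw [mem_ball_zero_iff, norm_mul, norm_rayDir, mul_one, Complex.norm_real,
      Real.norm_of_nonneg (by positivity)]
    linarith
  set y := ((ρ / 2 : ℝ) : ℂ) * rayDir Ψ
  refine ⟨L y - Complex.log (F y / F 0), ?_⟩
  have hlim : Tendsto (fun z => L y - Complex.log (F y / F 0) + Complex.log (F z / F 0))
      (𝓝[raySector Ψ ε] 0) (𝓝 (L y - Complex.log (F y / F 0) + 0)) := by
    refine Tendsto.const_add _ (Tendsto.mono_left ?_ nhdsWithin_le_nhds)
    have := (hlogc.continuousAt (Metric.ball_mem_nhds 0 hρ)).tendsto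
    simpa [div_self hF0] using this
  rw [add_zero] at hlim
  refine hlim.congr' ?_
  filter_upwards [inter_mem_nhdsWithin (raySector Ψ ε) (Metric.ball_mem_nhds (0 : ℂ) hρ)]
    with z hz
  rw [(isPreconnected_raySector_inter_ball Ψ ε ρ).eq_of_exp_eq hcont hexp hy hz]
  ring

theorem IsLogBranchOn.hasDerivAt_ray {L F : ℂ → ℂ} {Ψ ε : ℝ} (hε : 0 < ε)
    (hL : IsLogBranchOn L F (raySector Ψ ε)) {t : ℝ} (ht : 0 < t) :
    HasDerivAt (fun t : ℝ => L (t * rayDir Ψ)) (rayDir Ψ * logDeriv F (t * rayDir Ψ)) t := by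
  set z := (t : ℂ) * rayDir Ψ with hz
  have hmem := raySector_mem_nhds (Ψ := Ψ) hε ht
  have hLz : HasDerivAt L (deriv L z) z := (hL.holomorphic.differentiableAt hmem).hasDerivAt
  have hFz : F z ≠ 0 := by
    rw [← hL.exp_eq z (mem_of_mem_nhds hmem)]
    exact Complex.exp_ne_zero _
  have h1 : deriv L z = logDeriv F z := by
    have e1 : HasDerivAt F (Complex.exp (L z) * deriv L z) z :=
      hLz.cexp.congr_of_eventuallyEq (by
        filter_upwards [hmem] with w hw using (hL.exp_eq w hw).symm)
    rw [logDeriv_apply, e1.deriv, hL.exp_eq z (mem_of_mem_nhds hmem), mul_div_cancel_left₀ _ hFz]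
  have h2 : HasDerivAt (fun t : ℝ => (t : ℂ) * rayDir Ψ) (rayDir Ψ) t := by
    simpa using (Complex.ofRealCLM.hasDerivAt (x := t)).mul_const (rayDir Ψ)
  have := HasDerivAt.scomp t hLz h2
  rw [h1, smul_eq_mul] at this
  exact this

/-- Avoiding the sector means `|arg (a n e^{-iΨ})| ≥ ε`; the sign change turns this into an argument
of modulus at most `π - ε`. -/
theorem IsZetaSequence.isStieltjesSequence {a : ℕ → ℂ} {α Ψ ε : ℝ} (ha : IsZetaSequence a α Ψ ε) :
    ∃ κ, IsStieltjesSequence (fun n => -(a n * Complex.exp (-((Ψ : ℂ) * Complex.I)))) α κ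
      ⌊α⌋₊ := by
  have hnorm : ∀ n, ‖-(a n * Complex.exp (-((Ψ : ℂ) * Complex.I)))‖ = ‖a n‖ := by
    intro n
    rw [norm_neg, norm_mul, exp_neg_eq_inv_rayDir, norm_inv, norm_rayDir, inv_one, mul_one]
  have hne : ∀ n, -(a n * Complex.exp (-((Ψ : ℂ) * Complex.I))) ≠ 0 := fun n =>
    norm_pos_iff.1 (by rw [hnorm]; exact norm_pos_iff.2 (ha.ne_zero n))
  have harg : ∀ n, ε ≤ |(a n * (rayDir Ψ)⁻¹).arg| := by
    intro n
    by_contra! h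
    exact ha.notMem_sector n (mem_raySector_of_abs_arg_lt (ha.ne_zero n) h)
  have hεpi : ε ≤ Real.pi := (harg 0).trans (Complex.abs_arg_le_pi _)
  have harg' : ∀ n, |(-(a n * Complex.exp (-((Ψ : ℂ) * Complex.I)))).arg| ≤ Real.pi - ε := by
    intro n
    rw [exp_neg_eq_inv_rayDir]
    have h := harg n
    set z := a n * (rayDir Ψ)⁻¹
    have hz : z ≠ 0 := mul_ne_zero (ha.ne_zero n) (inv_ne_zero (rayDir_ne_zero Ψ))
    have hε := ha.eps_pos
    have h1 := Complex.neg_pi_lt_arg z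
    have h2 := Complex.arg_le_pi z
    rcases lt_trichotomy z.arg 0 with h0 | h0 | h0
    · rw [abs_of_neg h0] at h
      rw [Complex.arg_neg_eq_arg_add_pi_of_im_neg (Complex.arg_neg_iff.1 h0),
        abs_of_pos (by linarith)]
      linarith
    · rw [h0, abs_zero] at h
      linarith
    · rw [abs_of_pos h0] at h
      have h3 : 0 < z.im ∨ z.im = 0 ∧ z.re < 0 := by
        rcases (Complex.arg_nonneg_iff.1 h0.le).eq_or_lt with h4 | h4
        · refine Or.inr ⟨h4.symm, ?_⟩
          by_contra! h5
          exact h0.ne' (Complex.arg_eq_zero_iff.2 ⟨h5, h4.symm⟩)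
        · exact Or.inl h4
      rw [Complex.arg_neg_eq_arg_sub_pi_iff.2 h3, abs_of_nonpos (by linarith)]
      linarith
  have hcos : Real.cos ε < 1 := by
    rw [← Real.cos_zero]
    exact Real.cos_lt_cos_of_nonneg_of_le_pi le_rfl hεpi ha.eps_pos
  refine ⟨√((1 - Real.cos ε) / 2), Real.sqrt_pos.2 (by linarith), fun n t ht =>
    norm_add_lower_bound ht ha.eps_pos.le (harg' n), hne, fun σ hσ => ?_,
    Nat.floor_le ha.exponent_nonneg, Nat.lt_floor_add_one α⟩
  simp_rw [hnorm]
  exact ha.summable_norm_rpow hσ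

/-! ### Assembly along the ray. -/

/-- Coefficients of the primitive of `u T(t u)` with constant term `ℓ`. -/
noncomputable def rayPrimitiveCoeff (T : ℂ[X]) (u ℓ : ℂ) : ℕ → ℂ
  | 0 => ℓ
  | i + 1 => T.coeff i * u ^ (i + 1) / (i + 1)

theorem hasDerivAt_rayPrimitive {T : ℂ[X]} {p : ℕ} (hT : T ∈ Polynomial.degreeLT ℂ p) (u ℓ : ℂ)
    (t : ℝ) :
    HasDerivAt (fun t : ℝ => ∑ i ∈ Finset.range (p + 1), rayPrimitiveCoeff T u ℓ i * (t : ℂ) ^ i)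
      (u * T.eval (t * u)) t := by
  have hdeg : T.natDegree < p + 1 :=
    Nat.lt_succ_of_le (Polynomial.natDegree_le_of_degree_le (Polynomial.mem_degreeLT.1 hT).le)
  have hlast : T.coeff p = 0 := Polynomial.coeff_eq_zero_of_degree_lt (Polynomial.mem_degreeLT.1 hT)
  have h : HasDerivAt (fun z : ℂ => ∑ i ∈ Finset.range (p + 1), rayPrimitiveCoeff T u ℓ i * z ^ i)
      (∑ i ∈ Finset.range (p + 1), rayPrimitiveCoeff T u ℓ i * (i * (t : ℂ) ^ (i - 1))) (t : ℂ) :=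
    HasDerivAt.fun_sum fun i _ => (hasDerivAt_pow i (t : ℂ)).const_mul _
  refine h.comp_ofReal.congr_deriv ?_
  have heval : T.eval (t * u) = ∑ i ∈ Finset.range p, T.coeff i * (t * u) ^ i := by
    rw [Polynomial.eval_eq_sum_range' hdeg, Finset.sum_range_succ, hlast, zero_mul, add_zero]
  rw [heval, Finset.sum_range_succ']
  simp only [Nat.cast_zero, zero_mul, mul_zero, add_zero, Finset.mul_sum]
  refine Finset.sum_congr rfl fun i _ => ?_
  have : (i : ℂ) + 1 ≠ 0 := Nat.cast_add_one_ne_zero i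
  rw [rayPrimitiveCoeff, Nat.add_sub_cancel]
  push_cast
  field_simp
  ring

theorem stieltjesSum_ray (a : ℕ → ℂ) (Ψ : ℝ) (p : ℕ) (t : ℝ) :
    rayDir Ψ * ((t * rayDir Ψ) ^ p * ∑' n, (a n ^ p * (t * rayDir Ψ - a n))⁻¹)
      = stieltjesSum (fun n => -(a n * Complex.exp (-((Ψ : ℂ) * Complex.I)))) p t := by
  have hu := rayDir_ne_zero Ψ
  rw [stieltjesSum, ← mul_assoc, ← tsum_mul_left]
  refine tsum_congr fun n => ?_
  rw [exp_neg_eq_inv_rayDir]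
  set b := -(a n * (rayDir Ψ)⁻¹) with hb
  have ha : a n = -(rayDir Ψ * b) := by
    rw [hb]
    field_simp
  rw [ha, show (t : ℂ) * rayDir Ψ - -(rayDir Ψ * b) = rayDir Ψ * (t + b) by ring, neg_pow (t : ℂ),
    neg_pow (rayDir Ψ * b), mul_pow, mul_pow]
  have h1 : ((-1 : ℂ) ^ p) * (-1) ^ p = 1 := by
    rw [← mul_pow]
    norm_num
  have h2 : ((-1 : ℂ) ^ p)⁻¹ = (-1) ^ p := inv_eq_of_mul_eq_one_left h1
  simp only [mul_inv, h2]
  have h3 : rayDir Ψ ^ p ≠ 0 := pow_ne_zero _ hu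
  field_simp

/-- The exponential factor, common to all terms of the zeta series, is the source of the `iπ` in the
final formula. -/
theorem cutPow_eq {Ψ : ℝ} {z : ℂ} (hz : z ≠ 0) (s : ℂ) :
    cutPow Ψ z (-s) = Complex.exp (-s * ((Ψ - Real.pi) * Complex.I)) *
      (-(z * Complex.exp (-((Ψ : ℂ) * Complex.I)))) ^ (-s) := by
  have hne : -(z * Complex.exp (-((Ψ : ℂ) * Complex.I))) ≠ 0 :=
    neg_ne_zero.2 (mul_ne_zero hz (Complex.exp_ne_zero _))
  rw [cutPow, cutLog, Complex.cpow_def_of_ne_zero hne, ← Complex.exp_add]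
  ring_nf

theorem exists_zeta_continuation {a : ℕ → ℂ} {α Ψ ε : ℝ} {F L : ℂ → ℂ} {d : ℕ → ℕ → ℂ}
    {m N : ℕ} {δ : ℝ} (ha : IsZetaSequence a α Ψ ε) (hF : IsCharacteristicFunction F a)
    (hL : IsLogBranchOn L F (raySector Ψ ε)) (hexp : HasLogPowerExpansion L α Ψ ε d m 1 N δ) :
    ∃ ℓ : ℂ, Tendsto L (𝓝[raySector Ψ ε] 0) (𝓝 ℓ) ∧
      ∃ Z : ℂ → ℂ, IsZetaContinuation a α Ψ (α - (N : ℝ) / m - δ) Z ∧ AnalyticAt ℂ Z 0 ∧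
        Z 0 = (∑ j ∈ Finset.range (N + 1), if α - (j : ℝ) / m = 0 then d j 1 else 0) ∧
        deriv Z 0 = Complex.I * Real.pi * Z 0 +
          (∑ j ∈ Finset.range (N + 1), if α - (j : ℝ) / m = 0 then d j 0 else 0) - ℓ := by
  have hε := ha.eps_pos
  have hα := ha.exponent_nonneg
  set u := rayDir Ψ with hu
  set p := ⌊α⌋₊ with hp
  obtain ⟨κ, hb⟩ := ha.isStieltjesSequence
  set b : ℕ → ℂ := fun n => -(a n * Complex.exp (-((Ψ : ℂ) * Complex.I))) with hbdef
  obtain ⟨T, hT, hTe⟩ := hF.exists_logDeriv_eq ha hb.exponent_lt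
  have hF0 : F 0 ≠ 0 := by
    rw [← (hF.entire.analyticAt 0).analyticOrderAt_eq_zero, hF.zeros, Set.encard_eq_zero]
    exact Set.eq_empty_of_forall_notMem fun i hi => ha.ne_zero i hi
  obtain ⟨ℓ, hℓ⟩ := hL.exists_tendsto_zero hε hF.entire.continuous hF0
  refine ⟨ℓ, hℓ, ?_⟩
  set β := α - (N : ℝ) / m - δ with hβdef
  have hβ : β < 0 := by linarith [hexp.lt_div]
  set q := rayPrimitiveCoeff T u ℓ with hq
  set c : ℕ → ℂ := fun j => Complex.exp (((α - (j : ℝ) / m : ℝ) : ℂ) * (Ψ * Complex.I)) with hc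
  -- On the ray `ln z = ln t + iΨ`, so part of the logarithmic coefficient moves into the
  -- non-logarithmic one.
  set A₁ : ℕ → ℂ := fun j => c j * (d j 0 + d j 1 * (Ψ * Complex.I)) with hA₁
  set f : ℝ → ℂ := fun t => L (t * u) - ∑ i ∈ Finset.range (p + 1), q i * (t : ℂ) ^ i with hf
  set E : ℝ → ℂ := fun t => ∑ j ∈ Finset.range (N + 1),
    (A₁ j + c j * d j 1 * Real.log t) * (t : ℂ) ^ ((α - (j : ℝ) / m : ℝ) : ℂ) with hE
  have hfd : ∀ t, 0 < t → HasDerivAt f (stieltjesSum b p t) t := by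
    intro t ht
    have h1 := (hL.hasDerivAt_ray hε ht).sub (hasDerivAt_rayPrimitive hT u ℓ t)
    refine h1.congr_deriv ?_
    have hFz : F (t * u) ≠ 0 := by
      rw [← hL.exp_eq _ (ray_mem_raySector hε ht)]
      exact Complex.exp_ne_zero _
    rw [hTe _ hFz, mul_add, add_sub_cancel_left, stieltjesSum_ray]
  have hf0 : Tendsto f (𝓝[>] 0) (𝓝 0) := by
    have h1 : Tendsto (fun t : ℝ => L (t * u)) (𝓝[>] 0) (𝓝 ℓ) := hℓ.comp (tendsto_ray_zero hε)
    have h2 : Tendsto (fun t : ℝ => ∑ i ∈ Finset.range (p + 1), q i * (t : ℂ) ^ i)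
        (𝓝[>] 0) (𝓝 ℓ) := by
      have h3 : Continuous fun t : ℝ => ∑ i ∈ Finset.range (p + 1), q i * (t : ℂ) ^ i := by
        fun_prop
      refine (h3.tendsto' 0 ℓ ?_).mono_left nhdsWithin_le_nhds
      rw [Finset.sum_range_succ']
      simp [hq, rayPrimitiveCoeff]
    simpa using h1.sub h2
  have hEc : ContinuousOn E (Ioi 0) := by
    refine continuousOn_finsetSum _ fun j _ => ContinuousOn.mul ?_ (continuousOn_ofReal_cpow _)
    have : ContinuousOn (fun t : ℝ => ((Real.log t : ℝ) : ℂ)) (Ioi 0) :=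
      Complex.continuous_ofReal.comp_continuousOn
        (Real.continuousOn_log.mono fun t ht => ne_of_gt ht)
    fun_prop
  have hrc : ContinuousOn (fun t : ℝ => L (t * u) - E t) (Ioi 0) := ContinuousOn.sub
    (fun t ht => (hL.hasDerivAt_ray hε ht).continuousAt.continuousWithinAt) hEc
  have hrO : (fun t : ℝ => L (t * u) - E t) =O[atTop] fun t : ℝ => t ^ (-(-β)) := by
    refine (hexp.isLittleO.comp_tendsto (tendsto_ray_atTop hε)).isBigO.congr' ?_ ?_
    · filter_upwards [eventually_gt_atTop 0] with t ht
      simp only [Function.comp_apply, hE, hA₁, hc, ← hu]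
      congr 1
      refine Finset.sum_congr rfl fun j _ => ?_
      rw [Finset.sum_range_succ, Finset.sum_range_one, rayPow_ray Ψ ht, rayLog_ray Ψ ht]
      ring
    · filter_upwards [eventually_gt_atTop 0] with t ht
      rw [Function.comp_apply, norm_mul, norm_rayDir, mul_one, Complex.norm_real,
        Real.norm_of_nonneg ht.le, neg_neg]
  obtain ⟨G, hGm, hGa, hG0, hG1, hG⟩ := hb.exists_continuation (f := f)
    (r := fun t : ℝ => L (t * u) - E t)
    -- The subtracted polynomial is treated as further terms with exponents `i ≤ p ≤ α`; its
    -- constant term puts `-ℓ` into the derivative at `0`.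
    (K := (Finset.range (N + 1)).disjSum (Finset.range (p + 1)))
    (A := Sum.elim A₁ fun i => -q i) (B := Sum.elim (fun j => c j * d j 1) fun _ => 0)
    (w := Sum.elim (fun j => α - (j : ℝ) / m) fun i => (i : ℝ)) hβ hfd hf0 hrc hrO
    (by
      intro t ht
      rw [Finset.sum_disjSum]
      simp only [Sum.elim_inl, Sum.elim_inr, zero_mul, add_zero, Complex.ofReal_natCast,
        Complex.cpow_natCast, neg_mul, Finset.sum_neg_distrib]
      simp only [hf, hE]
      ring)
    (by
      intro k hk
      rcases k with j | i
      · have : (0 : ℝ) ≤ (j : ℝ) / m := by positivity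
        simp only [Sum.elim_inl]
        linarith
      · have hi : i ≤ p := by
          have := Finset.inr_mem_disjSum.1 hk
          exact Nat.lt_succ_iff.1 (Finset.mem_range.1 this)
        simp only [Sum.elim_inr]
        exact le_trans (by exact_mod_cast hi) hb.le_exponent)
  rw [Finset.sum_disjSum] at hG0 hG1
  simp only [Sum.elim_inl, Sum.elim_inr, ite_self, Finset.sum_const_zero, add_zero,
    Nat.cast_eq_zero] at hG0 hG1
  have hc1 : ∀ j : ℕ, α - (j : ℝ) / m = 0 → c j = 1 := by
    intro j hj
    simp only [hc, hj, Complex.ofReal_zero, zero_mul, Complex.exp_zero]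
  have hG0' : G 0 = ∑ j ∈ Finset.range (N + 1), if α - (j : ℝ) / m = 0 then d j 1 else 0 := by
    rw [hG0]
    refine Finset.sum_congr rfl fun j _ => ?_
    by_cases hj : α - (j : ℝ) / m = 0
    · exact (if_pos hj).trans (by rw [if_pos hj, hc1 j hj, one_mul])
    · exact (if_neg hj).trans (if_neg hj).symm
  have hG1' : deriv G 0 = (∑ j ∈ Finset.range (N + 1), if α - (j : ℝ) / m = 0 then d j 0 else 0)
      + G 0 * (Ψ * Complex.I) - ℓ := by
    rw [hG1, hG0', Finset.sum_mul, ← Finset.sum_add_distrib, sub_eq_add_neg]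
    congr 1
    · refine Finset.sum_congr rfl fun j _ => ?_
      by_cases hj : α - (j : ℝ) / m = 0
      · refine (if_pos hj).trans ?_
        rw [if_pos hj, if_pos hj]
        simp only [hA₁]
        rw [hc1 j hj, one_mul]
      · refine (if_neg hj).trans ?_
        rw [if_neg hj, if_neg hj, zero_mul, add_zero]
    · rw [Finset.sum_ite_eq' (Finset.range (p + 1)) 0, if_pos (by simp)]
      rfl
  set X : ℂ → ℂ := fun s => Complex.exp (-s * ((Ψ - Real.pi) * Complex.I)) with hX
  have hXd : Differentiable ℂ X := by fun_prop
  have hX1 : HasDerivAt X (-((Ψ - Real.pi) * Complex.I)) 0 := by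
    have := (((hasDerivAt_id (0 : ℂ)).neg).mul_const (((Ψ : ℂ) - Real.pi) * Complex.I)).cexp
    exact this.congr_deriv (by simp)
  have hX0 : X 0 = 1 := by simp [hX]
  -- `G` is controlled only for `Re s < p + 1`; further right the series itself is used, and the two
  -- agree on the strip `α < Re s < p + 1`.
  set Z₀ : ℂ → ℂ := fun s => if α < s.re then ∑' n, b n ^ (-s) else G s with hZ₀
  have hZ₀G : ∀ s : ℂ, s.re < p + 1 → Z₀ s = G s := by
    intro s hs
    simp only [hZ₀]
    split_ifs with h
    · exact (hG s h hs).symm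
    · rfl
  have hev : ∀ s : ℂ, s.re < p + 1 → Z₀ =ᶠ[𝓝 s] G := fun s hs => by
    filter_upwards [(isOpen_lt Complex.continuous_re continuous_const).mem_nhds hs] with z hz
    exact hZ₀G z hz
  have h0p : (0 : ℂ).re < p + 1 := by
    rw [Complex.zero_re]
    positivity
  have hXZ : (fun s => X s * Z₀ s) =ᶠ[𝓝 0] fun s => X s * G s := by
    filter_upwards [hev 0 h0p] with s hs
    rw [hs]
  refine ⟨fun s => X s * Z₀ s, ⟨fun s hs => ?_, fun s hs => ?_⟩, ?_, ?_, ?_⟩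
  · refine MeromorphicAt.mul (hXd.analyticAt s).meromorphicAt ?_
    by_cases hs' : s.re < p + 1
    · exact (hGm s ⟨hs, hs'⟩).congr ((hev s hs').symm.filter_mono nhdsWithin_le_nhds)
    · have hsα : α < s.re := hb.exponent_lt.trans_le (not_lt.1 hs')
      have hopen : IsOpen {s : ℂ | α < s.re} := isOpen_lt continuous_const Complex.continuous_re
      refine ((hb.differentiableOn_tsum_cpow.analyticAt (hopen.mem_nhds hsα)).meromorphicAt).congr
        (Filter.EventuallyEq.filter_mono ?_ nhdsWithin_le_nhds)
      filter_upwards [hopen.mem_nhds hsα] with z hz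
      simp only [hZ₀]
      rw [if_pos hz]
  · have h1 := (hb.summable_cpow hs).hasSum.mul_left (X s)
    simp only [hZ₀, if_pos hs]
    exact h1.congr_fun fun n => cutPow_eq (ha.ne_zero n) s
  · exact ((hXd.analyticAt 0).mul hGa).congr hXZ.symm
  · simp only
    rw [hX0, one_mul, hZ₀G 0 h0p, hG0']
  · rw [hXZ.deriv_eq]
    have h1 := (hX1.mul hGa.differentiableAt.hasDerivAt).deriv
    refine h1.trans ?_
    simp only
    rw [hX0, hG1', hZ₀G 0 h0p]
    ring

theorem mainTheorem6 (a : ℕ → ℂ) (α Ψ ε : ℝ) (F L : ℂ → ℂ) (d : ℕ → ℕ → ℂ) (m N : ℕ) (δ : ℝ)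
    (ha : IsZetaSequence a α Ψ ε)
    (hF : IsCharacteristicFunction F a)
    (hL : IsLogBranchOn L F (raySector Ψ ε))
    (hexp : HasLogPowerExpansion L α Ψ ε d m 1 N δ) :
    -- `ℓ` is `ln F(0)`, the limit of the chosen branch at the vertex of the sector
    ∃ ℓ : ℂ, Tendsto L (𝓝[raySector Ψ ε] 0) (𝓝 ℓ) ∧
      -- `ζ_S` continues meromorphically to a half-plane containing `0` and is regular at `0`
      (∃ Z : ℂ → ℂ, IsZetaContinuation a α Ψ (α - (N : ℝ) / m - δ) Z ∧ AnalyticAt ℂ Z 0) ∧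
      -- the derivative at `0` of the (unique) continuation
      ∀ (σ : ℝ) (Z : ℂ → ℂ), σ < 0 → IsZetaContinuation a α Ψ σ Z → AnalyticAt ℂ Z 0 →
        ((∀ j : ℕ, j ≤ N → α - (j : ℝ) / m ≠ 0) →
          deriv Z 0 = -ℓ ∧
          deriv Z 0 = Complex.I * Real.pi * Z 0 - ℓ) ∧
        (∀ j' : ℕ, j' ≤ N → α - (j' : ℝ) / m = 0 →
          deriv Z 0 = Complex.I * Real.pi * d j' 1 + d j' 0 - ℓ ∧
          deriv Z 0 = Complex.I * Real.pi * Z 0 + d j' 0 - ℓ) := by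
  obtain ⟨ℓ, hℓ, Z₀, hZ₀, hZ₀a, hval, hder⟩ := exists_zeta_continuation ha hF hL hexp
  refine ⟨ℓ, hℓ, ⟨Z₀, hZ₀, hZ₀a⟩, fun σ Z hσ hZ hZa => ?_⟩
  have hβ : α - (N : ℝ) / m - δ < 0 := by linarith [hexp.lt_div]
  have hev : Z =ᶠ[𝓝 0] Z₀ := by
    refine MeromorphicOn.eventuallyEq_of_eqOn_halfPlane (α := α)
      (τ := max σ (α - (N : ℝ) / m - δ)) (fun s hs => hZ.meromorphic s ?_)
      (fun s hs => hZ₀.meromorphic s ?_) (fun s hs => (hZ.hasSum s hs).unique (hZ₀.hasSum s hs))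
      ?_ hZa hZ₀a
    · exact lt_of_le_of_lt (le_max_left _ _) (show max σ _ < s.re from hs)
    · exact lt_of_le_of_lt (le_max_right _ _) (show max σ _ < s.re from hs)
    · rw [Complex.zero_re]
      exact max_lt hσ hβ
  rw [hev.deriv_eq, hev.eq_of_nhds]
  have hm : (m : ℝ) ≠ 0 := by exact_mod_cast hexp.m_pos.ne'
  constructor
  · intro hne
    have hzero : ∀ g : ℕ → ℂ,
        (∑ j ∈ Finset.range (N + 1), if α - (j : ℝ) / m = 0 then g j else 0) = 0 := fun g =>
      Finset.sum_eq_zero fun j hj =>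
        if_neg (hne j (Nat.lt_succ_iff.1 (Finset.mem_range.1 hj)))
    rw [hzero fun j => d j 1] at hval
    rw [hzero fun j => d j 0] at hder
    rw [hder, hval]
    constructor <;> ring
  · intro j' hj' hw
    -- The exponents `α - j/m` are pairwise distinct, so only `j'` contributes.
    have hone : ∀ g : ℕ → ℂ,
        (∑ j ∈ Finset.range (N + 1), if α - (j : ℝ) / m = 0 then g j else 0) = g j' := by
      intro g
      rw [Finset.sum_eq_single j', if_pos hw]
      · intro j _ hj
        refine if_neg fun h => hj ?_
        have h1 : (j : ℝ) / m = (j' : ℝ) / m := by linarith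
        exact_mod_cast (div_left_inj' hm).1 h1
      · intro h
        exact absurd (Finset.mem_range.2 (Nat.lt_succ_of_le hj')) h
    rw [hone fun j => d j 1] at hval
    rw [hone fun j => d j 0] at hder
    rw [hder, hval]
    exact ⟨rfl, rfl⟩
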